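/- Let $d$ be a dimension. For $\phi\in L^2(\mathbb{R}^d)$ (complex-valued) write $\hat\phi(\omega)=\int_{\mathbb{R}^d} e^{-i\omega\cdot y}\phi(y)\,dy$ for its ($L^2$-)Fourier transform. For $1\le p,q\le\infty$ and $r>0$, let $B_r$ be the open ball of radius $r$ centred at the origin and let $X^{p,q}_r$ be the space of measurable functions $f$ on $\mathbb{R}^d$ with $$\|f\|_{X^{p,q}_r}=\Big(\int_{\mathbb{R}^d}\|f(x+\cdot)\|_{L^p(B_r)}^q\,dx\Big)^{1/q}<\infty$$ (with the usual modification if $q=\infty$); put $X^{p,q}=X^{p,q}_1$ and $\|\nabla f\|_{X^{p,q}_r}=\|\,|\nabla f|\,\|_{X^{p,q}_r}$, derivatives being taken in the sense of distributions. For $s>0$ let $$U_s=\overline{\mathrm{span}\{\phi_{s,n}: n\in\mathbb{Z}^d\}}\subset L^2(\mathbb{R}^d),\qquad \phi_{s,n}(x)=s^{-d/2}\phi\Big(\frac{x-ns}{s}\Big).$$ Set $\langle t\rangle=(1+t^2)^{1/2}$ and $v(\omega)=\langle\omega_1\rangle\cdots\langle\omega_d\rangle$. Consider, for a function $\psi\in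 L^2(\mathbb{R}^d)$, the two conditions (a) $\psi\in X^{\infty,1}$; (b) there are $\alpha>1/2$ and $B'>0$ with $\sum_{k\in\mathbb{Z}^d}|(v^\alpha\hat\psi)(\omega-2\pi k)|^2\le B'$ for a.e. $\omega\in[0,2\pi]^d$. **Theorem.** Let $\phi\in L^2(\mathbb{R}^d)$ be such that there are constants $A,B>0$ with $$A\le\sum_{k\in\mathbb{Z}^d}|\hat\phi(\omega-2\pi k)|^2\le B\quad\text{for a.e. }\omega\in\mathbb{R}^d.$$ (i) If $\phi$ satisfies at least one of (a), (b), then there is $C>0$ such that for all $r,s>0$ and all $f\in U_s$, $$\|f\|_{X^{\infty,2}_r}\le C(1+r/s)^{d/2}\|f\|_{L^2}.$$ (ii) If for every $j=1,\dots,d$ the distributional derivative $\partial_j\phi$ is a function in $L^2(\mathbb{R}^d)$ satisfying at least one of (a), (b) (which of the two may depend on $j$), then there is $C>0$ such that for all $r,s>0$ and all $f\in U_s$, the distributional gradient $\nabla f$ is a function in $L^2(\mathbb{R}^d;\mathbb{C}^d)$ and $$\|\nabla f\|_{X^{\infty,2}_r}\le C s^{-1}(1+r/s)^{d/2}\|f\|_{L^2}.$$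 -/

import Mathlib

open MeasureTheory SchwartzMap FourierTransform LineDeriv
open scoped ENNReal

namespace RevHolder

noncomputable section

/-- Euclidean space `ℝ^d`. -/
abbrev E (d : ℕ) : Type := EuclideanSpace ℝ (Fin d)

/-- The space `L²(ℝ^d)` of complex-valued functions. -/
abbrev L2 (d : ℕ) : Type := Lp (α := E d) ℂ 2 (volume : Measure (E d))

/-- The lattice point of `ℤ^d`, seen in `ℝ^d`. -/
def latticePt {d : ℕ} (k : Fin d → ℤ) : E d := WithLp.toLp 2 (fun i => (k i : ℝ))

/-- The (extended) norm `‖f‖_{X^{p,q}_r}`: the `L^q` norm in `x ∈ ℝ^d` of the `L^p(B_r)` norm of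
`y ↦ f (x + y)`. -/
def amalgamNorm {d : ℕ} {F : Type*} [NormedAddCommGroup F] (p q : ℝ≥0∞) (r : ℝ) (f : E d → F) :
    ℝ≥0∞ :=
  eLpNorm (fun x : E d =>
    eLpNorm (fun y : E d => f (x + y)) p (volume.restrict (Metric.ball (0 : E d) r))) q volume

/-- Membership in the Wiener amalgam space `X^{p,q}_r`. -/
def MemAmalgam {d : ℕ} {F : Type*} [NormedAddCommGroup F] (p q : ℝ≥0∞) (r : ℝ) (f : E d → F) :
    Prop :=
  AEStronglyMeasurable f volume ∧ amalgamNorm p q r f < ∞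

/-- The Fourier transform of `f ∈ L²` in the normalization `∫ e^{-i ω·y} f(y) dy`. Mathlib's `𝓕`
uses `e^{-2π i ω·y}`, so the frequency is rescaled by `2π`. -/
def fourierAng {d : ℕ} (f : L2 d) (ω : E d) : ℂ := (𝓕 f : L2 d) ((2 * Real.pi)⁻¹ • ω)

/-- The weight `v(ω) = ⟨ω₁⟩ ⋯ ⟨ω_d⟩`, where `⟨t⟩ = (1 + t²)^{1/2}`. -/
def weight {d : ℕ} (ω : E d) : ℝ := ∏ i, Real.sqrt (1 + (ω i) ^ 2)

/-- The periodization condition `A ≤ ∑_k |φ̂(ω - 2πk)|² ≤ B` for a.e. `ω`. -/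
def RieszCondition {d : ℕ} (φ : L2 d) : Prop :=
  ∃ A B : ℝ, 0 < A ∧ 0 < B ∧ ∀ᵐ ω : E d,
    ENNReal.ofReal A ≤ ∑' k : Fin d → ℤ, ‖fourierAng φ (ω - (2 * Real.pi) • latticePt k)‖ₑ ^ 2 ∧
    ∑' k : Fin d → ℤ, ‖fourierAng φ (ω - (2 * Real.pi) • latticePt k)‖ₑ ^ 2 ≤ ENNReal.ofReal B

/-- The weighted periodization condition: for some `α > 1/2` and `B' > 0`,
`∑_k |(v^α φ̂)(ω - 2πk)|² ≤ B'` for a.e. `ω ∈ [0, 2π]^d`. -/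
def WeightedPeriodization {d : ℕ} (φ : L2 d) : Prop :=
  ∃ α B' : ℝ, 1 / 2 < α ∧ 0 < B' ∧
    ∀ᵐ ω : E d, (∀ i, ω i ∈ Set.Icc 0 (2 * Real.pi)) →
      ∑' k : Fin d → ℤ,
        ‖((weight (ω - (2 * Real.pi) • latticePt k) ^ α : ℝ) : ℂ) *
          fourierAng φ (ω - (2 * Real.pi) • latticePt k)‖ₑ ^ 2 ≤ ENNReal.ofReal B'

/-- `φ` belongs to the Wiener space `X^{∞,1}`, or satisfies the weighted periodization condition. -/
def RegularityCondition {d : ℕ} (φ : L2 d) : Prop :=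
  MemAmalgam ∞ 1 1 (φ : E d → ℂ) ∨ WeightedPeriodization φ

/-- `g` is the `j`-th partial derivative of `f` in the sense of (tempered) distributions. -/
def IsPartialDeriv {d : ℕ} (j : Fin d) (f g : L2 d) : Prop :=
  ∂_{(EuclideanSpace.single j (1 : ℝ) : E d)} (f : 𝓢'(E d, ℂ)) = (g : 𝓢'(E d, ℂ))

/-- Each distributional derivative `∂_j φ` satisfies the regularity condition. (Both alternatives
in that condition force `∂_j φ ∈ L²`.) -/
def GradientRegularityCondition {d : ℕ} (φ : L2 d) : Prop :=
  ∀ j : Fin d, ∃ g : L2 d, IsPartialDeriv j φ g ∧ RegularityCondition g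

/-- The function `φ_{s,n}(x) = s^{-d/2} φ((x - n s)/s)`. -/
def atom {d : ℕ} (φ : L2 d) (s : ℝ) (n : Fin d → ℤ) (x : E d) : ℂ :=
  ((s ^ (-((d : ℝ) / 2)) : ℝ) : ℂ) * φ (s⁻¹ • (x - s • latticePt n))

theorem memLp_atom {d : ℕ} (φ : L2 d) {s : ℝ} (hs : 0 < s) (n : Fin d → ℤ) :
    MemLp (atom φ s n) 2 (volume : Measure (E d)) := by
  have h1 : MemLp (fun x : E d => φ (s⁻¹ • x)) 2 volume := by
    have hne : s⁻¹ ≠ 0 := inv_ne_zero hs.ne'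
    have h := (Homeomorph.smulOfNeZero (α := E d) s⁻¹ hne).measurableEmbedding
    refine (h.memLp_map_measure_iff (g := (φ : E d → ℂ)) (μ := volume) (p := 2)).1 ?_
    have h2 : Measure.map (Homeomorph.smulOfNeZero (α := E d) s⁻¹ hne) volume = _ :=
      Measure.map_addHaar_smul (volume : Measure (E d)) hne
    rw [h2]
    exact (Lp.memLp φ).smul_measure ENNReal.ofReal_ne_top
  exact (h1.comp_measurePreserving
    (measurePreserving_sub_right (volume : Measure (E d)) (s • latticePt n))).const_mul _

/-- The approximation space `U_s`, the closed linear span in `L²` of the `φ_{s,n}`, `n ∈ ℤ^d`. -/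
def approxSpace {d : ℕ} (φ : L2 d) (s : ℝ) (hs : 0 < s) : Submodule ℂ (L2 d) :=
  (Submodule.span ℂ
    (Set.range fun n : Fin d → ℤ => (memLp_atom φ hs n).toLp (atom φ s n))).topologicalClosure

end

end RevHolder

/-!
The space `X^{∞,2}_r` is compared with its discrete version `wienerSq`, the sum over the lattice
cubes of the squared essential suprema: a ball of radius `r` centred at `x` meets the cube
`s (n + [0,1)^d)` only if `x` lies in a box of side `s + 2r`, which accounts for the factor
`(1 + r/s)^{d/2}` (`amalgamNorm_sq_le`). The dilation `φ ↦ s^{-d/2} φ(·/s)` is an isometry of `L²`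
that maps `U_1` onto `U_s`, so that only `s = 1` matters.

By Plancherel and Parseval on the torus, `‖∑ₖ cₖ φ(· - k)‖²` is the integral over the unit cube of
`|∑ₖ cₖ e^{-2πik·ξ}|²` against the periodization of `|φ̂|²` (`enorm_synth_sq`). The lower Riesz bound
therefore controls `∑ₖ |cₖ|²` by `‖∑ₖ cₖ φ(· - k)‖²`, and it remains to bound
`c ↦ ∑ₖ cₖ ψ(· - k)` from `ℓ²` to `X^{∞,2}`, where `ψ` is `φ` or one of its partial derivatives
(`SynthBounded`).

* If `ψ ∈ X^{∞,1}`, the suprema of `ψ` over the lattice cubes are summable, and the bound is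
  Young's inequality `ℓ¹ * ℓ² ⊆ ℓ²` (`synthBounded_of_memAmalgam`).
* If `v^α ψ̂` has bounded periodization, then `ψ = K * η`, where `K` is the tensor product of the
  gamma densities `t_+^{α-1} e^{-t}`, whose Fourier transform has modulus `Γ(α)^d v^{-α}`, and `η̂`
  has bounded periodization. The translates of `η` thus satisfy an upper Riesz bound, while
  convolution with `K` maps `L²` to `X^{∞,2}`, because for `α > 1/2` the local `L²` norms of `K` are
  finite and summable (`synthBounded_of_weightedPeriodization`).

The bounds pass to the closed span by lower semicontinuity of `wienerSq` under convergence in `L²`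
(`wienerSq_le_of_tendsto`). Since `wienerSq` dominates the squared `L²` norm, the partial
derivatives of a convergent sequence of finite combinations converge in `L²` as well, and the
distributional derivative has a closed graph.
-/

namespace RevHolder

noncomputable section

/-! ### Lattice cubes -/

/-- The lattice point of the half-open unit cube `n + [0,1)^d` containing `x`. -/
def floorPt {d : ℕ} (x : E d) : Fin d → ℤ := fun i => ⌊x i⌋

/-- The half-open lattice cube `n + [0,1)^d`. -/
def cube {d : ℕ} (n : Fin d → ℤ) : Set (E d) := floorPt ⁻¹' {n}

theorem mem_cube {d : ℕ} {n : Fin d → ℤ} {x : E d} : x ∈ cube n ↔ floorPt x = n := Iff.rfl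

theorem measurable_floorPt {d : ℕ} : Measurable (floorPt : E d → Fin d → ℤ) := by
  refine measurable_pi_iff.2 fun i => ?_
  exact Int.measurable_floor.comp (by fun_prop)

theorem measurableSet_cube {d : ℕ} (n : Fin d → ℤ) : MeasurableSet (cube n) :=
  measurable_floorPt (measurableSet_singleton n)

theorem floorPt_add_latticePt {d : ℕ} (x : E d) (k : Fin d → ℤ) :
    floorPt (x + latticePt k) = floorPt x + k := by
  ext i; simp [floorPt, latticePt]

theorem floorPt_sub_latticePt {d : ℕ} (x : E d) (k : Fin d → ℤ) :
    floorPt (x - latticePt k) = floorPt x - k := by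
  ext i; simp [floorPt, latticePt]

theorem lintegral_eq_tsum_cube {d : ℕ} (F : E d → ℝ≥0∞) :
    ∫⁻ x, F x = ∑' n : Fin d → ℤ, ∫⁻ x in cube n, F x := by
  rw [← lintegral_iUnion measurableSet_cube]
  · simp only [cube]
    rw [← Set.preimage_iUnion, Set.iUnion_of_singleton, Set.preimage_univ, Measure.restrict_univ]
  intro a b hab
  exact Disjoint.preimage _ (Set.disjoint_singleton.2 hab)

theorem volume_box {d : ℕ} (a b : Fin d → ℝ) :
    volume {x : E d | ∀ i, x i ∈ Set.Icc (a i) (b i)} = ∏ i, ENNReal.ofReal (b i - a i) := by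
  rw [← Real.volume_Icc_pi, ← (PiLp.volume_preserving_ofLp (Fin d)).measure_preimage
    measurableSet_Icc.nullMeasurableSet]
  congr 1
  ext x
  simp [Pi.le_def, forall_and]

/-! ### Affine changes of variables -/

theorem map_affine {d : ℕ} {s : ℝ} (hs : 0 < s) (v : E d) :
    Measure.map (fun x : E d => s⁻¹ • (x - v)) volume = ENNReal.ofReal (s ^ d) • volume := by
  have h1 : (fun x : E d => s⁻¹ • (x - v)) = (fun x => s⁻¹ • x) ∘ (fun x => x - v) := rfl
  rw [h1, ← Measure.map_map (by fun_prop) (by fun_prop),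
    (measurePreserving_sub_right (volume : Measure (E d)) v).map_eq,
    Measure.map_addHaar_smul _ (inv_ne_zero hs.ne')]
  simp [abs_of_pos hs]

theorem measurableEmbedding_affine {d : ℕ} {s : ℝ} (hs : 0 < s) (v : E d) :
    MeasurableEmbedding (fun x : E d => s⁻¹ • (x - v)) :=
  (((MeasurableEquiv.subRight v).trans
    (MeasurableEquiv.smul₀ s⁻¹ (inv_ne_zero hs.ne')))).measurableEmbedding

theorem lintegral_affine {d : ℕ} {s : ℝ} (hs : 0 < s) (v : E d) (F : E d → ℝ≥0∞) :
    ∫⁻ x, F (s⁻¹ • (x - v)) = ENNReal.ofReal (s ^ d) * ∫⁻ x, F x := by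
  rw [← (measurableEmbedding_affine hs v).lintegral_map, map_affine hs, lintegral_smul_measure,
    smul_eq_mul]

theorem quasiMeasurePreserving_affine {d : ℕ} {s : ℝ} (hs : 0 < s) (v : E d) :
    Measure.QuasiMeasurePreserving (fun x : E d => s⁻¹ • (x - v)) volume volume := by
  refine ⟨(measurableEmbedding_affine hs v).measurable, ?_⟩
  rw [map_affine hs]
  exact Measure.smul_absolutelyContinuous

theorem ae_affine {d : ℕ} {s : ℝ} (hs : 0 < s) (v : E d) {p : E d → Prop}
    (h : ∀ᵐ x, p x) : ∀ᵐ x : E d, p (s⁻¹ • (x - v)) :=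
  (quasiMeasurePreserving_affine hs v).ae h

theorem ae_sub {d : ℕ} (v : E d) {p : E d → Prop} (h : ∀ᵐ x, p x) : ∀ᵐ x : E d, p (x - v) := by
  simpa using ae_affine one_pos v h

/-! ### The square of the `L²` norm -/

theorem eLpNorm_two_sq {α F : Type*} [MeasurableSpace α] [ENorm F] {μ : Measure α} (f : α → F) :
    eLpNorm f 2 μ ^ 2 = ∫⁻ x, ‖f x‖ₑ ^ 2 ∂μ := by
  rw [eLpNorm_eq_lintegral_rpow_enorm_toReal two_ne_zero ENNReal.ofNat_ne_top,
    ← ENNReal.rpow_natCast, ← ENNReal.rpow_mul]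
  simp

theorem enorm_sq_eq_lintegral {d : ℕ} (f : L2 d) : ‖f‖ₑ ^ 2 = ∫⁻ x, ‖f x‖ₑ ^ 2 := by
  rw [Lp.enorm_def, eLpNorm_two_sq]

theorem enorm_eq_of_lintegral {d : ℕ} {f g : L2 d}
    (h : ∫⁻ x, ‖f x‖ₑ ^ 2 = ∫⁻ x, ‖g x‖ₑ ^ 2) : ‖f‖ = ‖g‖ := by
  rw [← enorm_sq_eq_lintegral, ← enorm_sq_eq_lintegral] at h
  have := (ENNReal.pow_right_strictMono two_ne_zero).injective h
  simpa [enorm_eq_iff_norm_eq] using this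

/-! ### The atoms as images of an isometry -/

theorem enorm_atom_factor_sq {d : ℕ} {s : ℝ} (hs : 0 < s) :
    ‖((s ^ (-((d : ℝ) / 2)) : ℝ) : ℂ)‖ₑ ^ 2 = ENNReal.ofReal (s ^ d)⁻¹ := by
  rw [← ofReal_norm, ← ENNReal.ofReal_pow (norm_nonneg _), Complex.norm_real,
    Real.norm_of_nonneg (by positivity), ← Real.rpow_natCast, ← Real.rpow_mul hs.le,
    ← Real.rpow_natCast, ← Real.rpow_neg hs.le]
  congr 2
  push_cast
  ring

/-- The isometry `φ ↦ φ_{s,n}` of `L²`, where `φ_{s,n}(x) = s^{-d/2} φ((x - n s)/s)`. -/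
def shift {d : ℕ} {s : ℝ} (hs : 0 < s) (n : Fin d → ℤ) : L2 d →ₗᵢ[ℂ] L2 d where
  toFun φ := (memLp_atom φ hs n).toLp (atom φ s n)
  map_add' φ ψ := by
    rw [← MemLp.toLp_add]
    refine MemLp.toLp_congr _ _ ?_
    filter_upwards [ae_affine hs (s • latticePt n) (Lp.coeFn_add φ ψ)] with x hx
    simp only [atom, Pi.add_apply, hx, mul_add]
  map_smul' c φ := by
    rw [RingHom.id_apply, ← MemLp.toLp_const_smul]
    refine MemLp.toLp_congr _ _ ?_
    filter_upwards [ae_affine hs (s • latticePt n) (Lp.coeFn_smul c φ)] with x hx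
    simp only [atom, Pi.smul_apply, hx, smul_eq_mul]
    ring
  norm_map' φ := by
    refine enorm_eq_of_lintegral ?_
    have h1 : ∫⁻ x, ‖((memLp_atom φ hs n).toLp (atom φ s n) : L2 d) x‖ₑ ^ 2
        = ∫⁻ x, ENNReal.ofReal (s ^ d)⁻¹ * ‖φ (s⁻¹ • (x - s • latticePt n))‖ₑ ^ 2 := by
      refine lintegral_congr_ae ?_
      filter_upwards [(memLp_atom φ hs n).coeFn_toLp] with x hx
      rw [hx, atom, enorm_mul, mul_pow, enorm_atom_factor_sq hs]
    rw [LinearMap.coe_mk, AddHom.coe_mk, h1, lintegral_const_mul' _ _ ENNReal.ofReal_ne_top,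
      lintegral_affine hs _ (fun y => ‖φ y‖ₑ ^ 2),
      ← mul_assoc, ← ENNReal.ofReal_mul (by positivity), inv_mul_cancel₀ (by positivity)]
    simp

theorem coeFn_shift {d : ℕ} {s : ℝ} (hs : 0 < s) (n : Fin d → ℤ) (φ : L2 d) :
    shift hs n φ =ᵐ[volume] atom φ s n := (memLp_atom φ hs n).coeFn_toLp

theorem coeFn_shift_one {d : ℕ} (n : Fin d → ℤ) (φ : L2 d) :
    shift one_pos n φ =ᵐ[volume] fun x => φ (x - latticePt n) := by
  filter_upwards [coeFn_shift one_pos n φ] with x hx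
  rw [hx]
  simp [atom]

theorem shift_eq_comp {d : ℕ} {s : ℝ} (hs : 0 < s) (n : Fin d → ℤ) (φ : L2 d) :
    shift hs n φ = shift hs 0 (shift one_pos n φ) := by
  refine Lp.ext ?_
  filter_upwards [coeFn_shift hs n φ, coeFn_shift hs 0 (shift one_pos n φ),
    ae_affine hs 0 (coeFn_shift_one n φ)] with x h1 h2 h3
  have h0 : (latticePt (0 : Fin d → ℤ) : E d) = 0 := by ext i; simp [latticePt]
  rw [h1, h2, atom, atom, h0, smul_zero, h3, sub_zero, smul_sub, smul_smul,
    inv_mul_cancel₀ hs.ne', one_smul]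

/-! ### Cube suprema and the amalgam norm -/

/-- The square of the essential supremum of `h` on the lattice cube `n + [0,1)^d`. -/
def cubeSupSq {d : ℕ} {F : Type*} [ENorm F] (h : E d → F) (n : Fin d → ℤ) : ℝ≥0∞ :=
  eLpNormEssSup h (volume.restrict (cube n)) ^ 2

/-- The discrete version `∑ₙ ‖h‖²_{L^∞(n + [0,1)^d)}` of the squared norm of `X^{∞,2}`. -/
def wienerSq {d : ℕ} {F : Type*} [ENorm F] (h : E d → F) : ℝ≥0∞ := ∑' n, cubeSupSq h n

theorem ae_le_cubeSupSq {d : ℕ} {F : Type*} [ENorm F] (h : E d → F) :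
    ∀ᵐ x, ‖h x‖ₑ ^ 2 ≤ cubeSupSq h (floorPt x) := by
  have : ∀ n : Fin d → ℤ, ∀ᵐ x, x ∈ cube n →
      ‖h x‖ₑ ≤ eLpNormEssSup h (volume.restrict (cube n)) := fun n =>
    (ae_restrict_iff' (measurableSet_cube n)).1 ae_le_eLpNormEssSup
  filter_upwards [ae_all_iff.2 this] with x hx
  exact pow_le_pow_left' (hx _ rfl) 2

theorem essSup_cube_le {d : ℕ} {F : Type*} [ENorm F] {h : E d → F} {n : Fin d → ℤ} {c : ℝ≥0∞}
    (hc : ∀ᵐ x, x ∈ cube n → ‖h x‖ₑ ≤ c) :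
    eLpNormEssSup h (volume.restrict (cube n)) ≤ c :=
  eLpNormEssSup_le_of_ae_enorm_bound ((ae_restrict_iff' (measurableSet_cube n)).2 hc)

theorem volume_cube {d : ℕ} (n : Fin d → ℤ) : volume (cube n : Set (E d)) ≤ 1 := by
  have h : (cube n : Set (E d)) ⊆ {x | ∀ i, x i ∈ Set.Icc ((n i : ℝ)) (n i + 1)} := by
    rintro x rfl i
    exact ⟨Int.floor_le _, (Int.lt_floor_add_one _).le⟩
  refine (measure_mono h).trans ?_
  rw [volume_box]
  simp

theorem lintegral_enorm_sq_le_wienerSq {d : ℕ} {F : Type*} [ENorm F] (f : E d → F) :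
    ∫⁻ x, ‖f x‖ₑ ^ 2 ≤ wienerSq f := by
  rw [lintegral_eq_tsum_cube]
  refine ENNReal.tsum_le_tsum fun n => ?_
  have h1 : ∫⁻ x in cube n, ‖f x‖ₑ ^ 2 ≤ ∫⁻ x in cube n, cubeSupSq f n := by
    refine lintegral_mono_ae ?_
    filter_upwards [ae_restrict_of_ae (ae_le_cubeSupSq f),
      ae_restrict_mem (measurableSet_cube n)] with x hx hn
    rwa [mem_cube.1 hn] at hx
  refine h1.trans ?_
  rw [setLIntegral_const]
  exact mul_le_of_le_one_right' (volume_cube n)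

theorem enorm_sq_le_wienerSq {d : ℕ} (f : L2 d) : ‖f‖ₑ ^ 2 ≤ wienerSq f := by
  rw [enorm_sq_eq_lintegral]
  exact lintegral_enorm_sq_le_wienerSq f

/-- A ball `B_r(x)` meets the cube `s (n + [0,1)^d)` only if `x` lies in a box of side `s + 2 r`, so
that the squared amalgam norm is controlled by the sum of the squared suprema over the cubes. -/
theorem amalgamNorm_sq_le {d : ℕ} {F : Type*} [NormedAddCommGroup F] (f : E d → F)
    (M : (Fin d → ℤ) → ℝ≥0∞) {r s : ℝ} (hr : 0 < r) (hs : 0 < s)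
    (h : ∀ᵐ x, ‖f x‖ₑ ^ 2 ≤ M (floorPt (s⁻¹ • x))) :
    amalgamNorm ∞ 2 r f ^ 2 ≤ ENNReal.ofReal ((s + 2 * r) ^ d) * ∑' n, M n := by
  set S : (Fin d → ℤ) → Set (E d) := fun n =>
    {x | ∀ i, x i ∈ Set.Icc (s * n i - r) (s * n i + s + r)} with hS
  have hSm : ∀ n, MeasurableSet (S n) := fun n => by
    simp only [hS, Set.ofPred_forall]
    refine MeasurableSet.iInter fun i => ?_
    exact measurableSet_Icc.preimage (by fun_prop : Measurable fun x : E d => x i)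
  have hvol : ∀ n, volume (S n) = ENNReal.ofReal ((s + 2 * r) ^ d) := fun n => by
    rw [hS, volume_box]
    rw [Finset.prod_congr rfl (g := fun _ => ENNReal.ofReal (s + 2 * r))
      (fun i _ => by congr 1; ring), Finset.prod_const, Finset.card_univ, Fintype.card_fin,
      ENNReal.ofReal_pow (by positivity)]
  rw [amalgamNorm, eLpNorm_two_sq]
  have key : ∀ x : E d, ‖eLpNorm (fun y : E d => f (x + y)) ∞
      (volume.restrict (Metric.ball (0 : E d) r))‖ₑ ^ 2 ≤
      ∑' n, (S n).indicator (fun _ => M n) x := by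
    intro x
    rw [enorm_eq_self, eLpNorm_exponent_top]
    set T := ∑' n, (S n).indicator (fun _ => M n) x with hT
    have hb : eLpNormEssSup (fun y : E d => f (x + y))
        (volume.restrict (Metric.ball (0 : E d) r)) ≤ T ^ (1 / 2 : ℝ) := by
      refine eLpNormEssSup_le_of_ae_enorm_bound ?_
      have h' : ∀ᵐ y : E d, ‖f (x + y)‖ₑ ^ 2 ≤ M (floorPt (s⁻¹ • (x + y))) := by
        have := ae_sub (-x) h
        simpa [sub_neg_eq_add, add_comm] using this
      filter_upwards [ae_restrict_of_ae h', ae_restrict_mem measurableSet_ball] with y hy hyr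
      have hx : x ∈ S (floorPt (s⁻¹ • (x + y))) := by
        intro i
        have hyi : |y i| < r := by
          have h1 : ‖y i‖ ≤ ‖y‖ := PiLp.norm_apply_le y i
          rw [mem_ball_zero_iff] at hyr
          exact lt_of_le_of_lt h1 hyr
        have h1 := Int.floor_le ((s⁻¹ • (x + y)) i)
        have h2 := (Int.lt_floor_add_one ((s⁻¹ • (x + y)) i)).le
        have h3 : (s⁻¹ • (x + y)) i = (x i + y i) / s := by
          simp [div_eq_inv_mul, mul_add]
        simp only [h3] at h1 h2
        have h4 := (le_div_iff₀ hs).1 h1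
        have h5 := (div_le_iff₀ hs).1 h2
        rw [abs_lt] at hyi
        simp only [floorPt, h3, Set.mem_Icc]
        constructor <;> nlinarith
      have hle : ‖f (x + y)‖ₑ ^ 2 ≤ T := by
        refine hy.trans (le_trans ?_ (ENNReal.le_tsum (floorPt (s⁻¹ • (x + y)))))
        rw [Set.indicator_of_mem hx]
      calc ‖f (x + y)‖ₑ = (‖f (x + y)‖ₑ ^ 2) ^ (1 / 2 : ℝ) := by
            rw [← ENNReal.rpow_natCast, ← ENNReal.rpow_mul]; simp
        _ ≤ T ^ (1 / 2 : ℝ) := ENNReal.rpow_le_rpow hle (by norm_num)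
    refine (pow_le_pow_left' hb 2).trans ?_
    rw [← ENNReal.rpow_natCast, ← ENNReal.rpow_mul]; simp
  refine (lintegral_mono key).trans ?_
  rw [lintegral_tsum fun n => (measurable_const.indicator (hSm n)).aemeasurable]
  simp_rw [lintegral_indicator (hSm _), setLIntegral_const, hvol]
  rw [ENNReal.tsum_mul_right, mul_comm]

/-! ### Lower semicontinuity -/

/-- Along an almost everywhere convergent subsequence the essential suprema are lower
semicontinuous, and Fatou's lemma applies to the sum over the cubes. -/
theorem wienerSq_le_of_tendsto {d : ℕ} {g : ℕ → L2 d} {g₀ : L2 d} {C : ℕ → ℝ≥0∞} {C₀ : ℝ≥0∞}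
    (hg : Filter.Tendsto g Filter.atTop (nhds g₀)) (hC : Filter.Tendsto C Filter.atTop (nhds C₀))
    (h : ∀ j, wienerSq (g j) ≤ C j) : wienerSq g₀ ≤ C₀ := by
  obtain ⟨ns, hns, hae⟩ := (tendstoInMeasure_of_tendsto_Lp hg).exists_seq_tendsto_ae
  have h1 : ∀ n, cubeSupSq g₀ n ≤
      Filter.liminf (fun j => cubeSupSq (g (ns j)) n) Filter.atTop := by
    intro n
    have h2 := Lp.eLpNorm_lim_le_liminf_eLpNorm (p := ∞) (μ := volume.restrict (cube n))
      (f := fun j => g (ns j)) (fun j => (Lp.aestronglyMeasurable _).restrict) g₀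
      (ae_restrict_of_ae hae)
    simp only [eLpNorm_exponent_top] at h2
    have hmono : Monotone fun x : ℝ≥0∞ => x ^ 2 := fun a b hab => pow_le_pow_left' hab 2
    refine (hmono h2).trans (le_of_eq ?_)
    exact hmono.map_liminf_of_continuousAt _ (by fun_prop)
  calc wienerSq g₀ ≤ ∑' n, Filter.liminf (fun j => cubeSupSq (g (ns j)) n) Filter.atTop :=
        ENNReal.tsum_le_tsum h1
    _ ≤ Filter.liminf (fun j => wienerSq (g (ns j))) Filter.atTop := by
        simp only [wienerSq, ← lintegral_count]
        exact lintegral_liminf_le fun j => measurable_of_countable _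
    _ ≤ Filter.liminf (fun j => C (ns j)) Filter.atTop :=
        Filter.liminf_le_liminf (Filter.Eventually.of_forall fun j => h _)
    _ = C₀ := (hC.comp hns.tendsto_atTop).liminf_eq

/-! ### Discrete Young inequality -/

/-- The Cauchy–Schwarz inequality with respect to the weights `aₖ`. -/
theorem tsum_mul_sq_le {ι : Type*} [Countable ι] (a b : ι → ℝ≥0∞) :
    (∑' k, a k * b k) ^ 2 ≤ (∑' k, a k) * ∑' k, a k * b k ^ 2 := by
  let _ : MeasurableSpace ι := ⊤
  have h := ENNReal.lintegral_mul_le_Lp_mul_Lq (Measure.count : Measure ι)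
    Real.HolderConjugate.two_two (f := fun k => a k ^ (1 / 2 : ℝ))
    (g := fun k => a k ^ (1 / 2 : ℝ) * b k) (measurable_of_countable _).aemeasurable
    (measurable_of_countable _).aemeasurable
  simp only [lintegral_count, Pi.mul_apply] at h
  have e0 : ∀ x : ℝ≥0∞, x ^ (1 / 2 : ℝ) * x ^ (1 / 2 : ℝ) = x := fun x => by
    rw [← ENNReal.rpow_add_of_nonneg _ _ (by norm_num) (by norm_num)]; norm_num
  have e1 : ∀ k, a k ^ (1 / 2 : ℝ) * (a k ^ (1 / 2 : ℝ) * b k) = a k * b k := fun k => by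
    rw [← mul_assoc, e0]
  have e2 : ∀ k, (a k ^ (1 / 2 : ℝ)) ^ (2 : ℝ) = a k := fun k => by
    rw [← ENNReal.rpow_mul]; norm_num
  have e3 : ∀ k, (a k ^ (1 / 2 : ℝ) * b k) ^ (2 : ℝ) = a k * b k ^ 2 := fun k => by
    rw [ENNReal.mul_rpow_of_nonneg _ _ (by norm_num), e2]; norm_num
  simp only [e1, e2, e3] at h
  refine (pow_le_pow_left' h 2).trans (le_of_eq ?_)
  rw [sq]
  have (x y : ℝ≥0∞) : x * y * (x * y) = x * x * (y * y) := by ring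
  rw [this, e0, e0]

theorem tsum_conv_sq_le {ι : Type*} [AddCommGroup ι] [Countable ι] (a b : ι → ℝ≥0∞) :
    ∑' n, (∑' k, a k * b (n - k)) ^ 2 ≤ (∑' k, a k) ^ 2 * ∑' k, b k ^ 2 := by
  calc ∑' n, (∑' k, a k * b (n - k)) ^ 2
      ≤ ∑' n, (∑' k, a k) * ∑' k, a k * b (n - k) ^ 2 :=
        ENNReal.tsum_le_tsum fun n => tsum_mul_sq_le _ _
    _ = (∑' k, a k) * ∑' k, a k * ∑' n, b (n - k) ^ 2 := by
        rw [ENNReal.tsum_mul_left, ENNReal.tsum_comm]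
        simp_rw [ENNReal.tsum_mul_left]
    _ = (∑' k, a k) * ∑' k, a k * ∑' n, b n ^ 2 := by
        congr 2
        ext k
        rw [← (Equiv.subRight k).tsum_eq (fun n => b n ^ 2)]
        rfl
    _ = _ := by rw [ENNReal.tsum_mul_right]; ring

/-! ### Finite linear combinations of lattice translates -/

/-- The finite linear combination `∑ₖ cₖ φ(· - k)` of lattice translates of `φ`. -/
def synth {d : ℕ} (φ : L2 d) (c : (Fin d → ℤ) →₀ ℂ) : L2 d :=
  Finsupp.linearCombination ℂ (fun k => shift one_pos k φ) c

theorem synth_eq {d : ℕ} (φ : L2 d) (c : (Fin d → ℤ) →₀ ℂ) :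
    synth φ c = ∑ k ∈ c.support, c k • shift one_pos k φ := Finsupp.linearCombination_apply _ _

theorem synth_sub {d : ℕ} (φ : L2 d) (c c' : (Fin d → ℤ) →₀ ℂ) :
    synth φ (c - c') = synth φ c - synth φ c' := map_sub _ _ _

theorem coeFn_sum {α ι : Type*} [MeasurableSpace α] {μ : Measure α} {p : ℝ≥0∞} (s : Finset ι)
    (f : ι → Lp ℂ p μ) : ⇑(∑ i ∈ s, f i) =ᵐ[μ] fun x => ∑ i ∈ s, f i x := by
  classical
  induction s using Finset.induction_on with
  | empty =>
    rw [Finset.sum_empty]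
    filter_upwards [Lp.coeFn_zero ℂ p μ] with x hx
    simpa using hx
  | insert a s ha ih =>
    rw [Finset.sum_insert ha]
    filter_upwards [Lp.coeFn_add (f a) (∑ i ∈ s, f i), ih] with x h1 h2
    rw [h1, Pi.add_apply, h2, Finset.sum_insert ha]

theorem coeFn_synth {d : ℕ} (φ : L2 d) (c : (Fin d → ℤ) →₀ ℂ) :
    synth φ c =ᵐ[volume] fun x => ∑ k ∈ c.support, c k * φ (x - latticePt k) := by
  rw [synth_eq]
  have h1 : ∀ k ∈ c.support, ∀ᵐ x, (c k • shift one_pos k φ : L2 d) x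
      = c k * φ (x - latticePt k) := fun k _ => by
    filter_upwards [Lp.coeFn_smul (c k) (shift one_pos k φ), coeFn_shift_one k φ] with x h2 h3
    rw [h2, Pi.smul_apply, h3, smul_eq_mul]
  filter_upwards [coeFn_sum c.support fun k => c k • shift one_pos k φ,
    (Finset.eventually_all _).2 h1] with x h2 h3
  rw [h2]
  exact Finset.sum_congr rfl h3

/-- The map `c ↦ ∑ₖ cₖ ψ(· - k)` is bounded from `ℓ²` to the amalgam space `X^{∞,2}`. -/
def SynthBounded {d : ℕ} (ψ : L2 d) : Prop :=
  ∃ C : ℝ≥0∞, C ≠ ∞ ∧ ∀ c : (Fin d → ℤ) →₀ ℂ, wienerSq (synth ψ c) ≤ C * ∑' k, ‖c k‖ₑ ^ 2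

/-! ### Generators in `X^{∞,1}` -/

/-- The unit cubes are covered by finitely many balls of radius `1/2` up to lattice translations;
for each of these balls the lattice translates are pairwise disjoint, so that the sum of the
suprema over the translates is controlled by the integral of the local suprema. -/
theorem tsum_essSup_cube_ne_top {d : ℕ} {ψ : E d → ℂ} (h : MemAmalgam ∞ 1 1 ψ) :
    ∑' n : Fin d → ℤ, eLpNormEssSup ψ (volume.restrict (cube n)) ≠ ∞ := by
  set G : E d → ℝ≥0∞ := fun x => eLpNorm (fun y : E d => ψ (x + y)) ∞
    (volume.restrict (Metric.ball (0 : E d) 1)) with hG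
  have hfin : ∫⁻ x, G x < ∞ := by
    have := h.2
    rw [amalgamNorm, eLpNorm_one_eq_lintegral_enorm] at this
    simpa only [enorm_eq_self] using this
  set Q : Set (E d) := {x | ∀ i, x i ∈ Set.Icc (0 : ℝ) 1} with hQ
  have hQc : IsCompact Q := by
    have h1 : Q = (PiLp.homeomorph 2 (fun _ : Fin d => ℝ)) ⁻¹'
        (Set.univ.pi fun _ => Set.Icc 0 1) := by
      ext x
      rw [Set.mem_preimage, Set.mem_univ_pi]
      rfl
    rw [h1, Homeomorph.isCompact_preimage]
    exact isCompact_univ_pi fun _ => isCompact_Icc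
  obtain ⟨P, hPf, hPc⟩ :=
    Metric.totallyBounded_iff.1 hQc.totallyBounded (1 / 2) (by norm_num)
  have hball : ∀ (y : E d), ∀ᵐ z, z ∈ Metric.ball y (1 / 2) →
      ‖ψ z‖ₑ * volume (Metric.ball (0 : E d) (1 / 2)) ≤ ∫⁻ x in Metric.ball y (1 / 2), G x := by
    intro y
    -- the supremum over the small ball is at most `G x`, for each `x` in that ball
    set A := eLpNormEssSup ψ (volume.restrict (Metric.ball y (1 / 2)))
    have hA : ∀ x ∈ Metric.ball y (1 / 2), A ≤ G x := by
      intro x hx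
      refine eLpNormEssSup_le_of_ae_enorm_bound ((ae_restrict_iff' measurableSet_ball).2 ?_)
      have h1 : ∀ᵐ w : E d, w ∈ Metric.ball (0 : E d) 1 → ‖ψ (x + w)‖ₑ ≤ G x := by
        refine (ae_restrict_iff' measurableSet_ball).1 ?_
        rw [hG]
        simp only [eLpNorm_exponent_top]
        exact ae_le_eLpNormEssSup
      filter_upwards [ae_sub x h1] with z hz hzy
      have := hz (by
        rw [mem_ball_zero_iff, ← dist_eq_norm]
        rw [Metric.mem_ball] at hzy hx
        have := dist_triangle_right z x y
        linarith)
      simpa using this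
    have h2 : A * volume (Metric.ball (0 : E d) (1 / 2)) ≤ ∫⁻ x in Metric.ball y (1 / 2), G x := by
      rw [← Measure.addHaar_ball_center (volume : Measure (E d)) y, ← setLIntegral_const]
      exact setLIntegral_mono' measurableSet_ball hA
    filter_upwards [(ae_restrict_iff' measurableSet_ball).1
      (ae_le_eLpNormEssSup (f := ψ) (μ := volume.restrict (Metric.ball y (1 / 2))))] with z hz hzy
    exact (mul_le_mul_left (hz hzy) _).trans h2
  set V := volume (Metric.ball (0 : E d) (1 / 2)) with hV
  have hV0 : V ≠ 0 := (Metric.measure_ball_pos _ _ (by norm_num)).ne'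
  have hVt : V ≠ ∞ := measure_ball_lt_top.ne
  have hcube : ∀ n : Fin d → ℤ, eLpNormEssSup ψ (volume.restrict (cube n)) ≤
      (∑ p ∈ hPf.toFinset, ∫⁻ x in Metric.ball (p + latticePt n) (1 / 2), G x) / V := by
    intro n
    refine essSup_cube_le ?_
    have h1 : ∀ p ∈ hPf.toFinset, _ := fun p _ => hball (p + latticePt n)
    filter_upwards [(Finset.eventually_all _).2 h1] with z hz hzn
    have hzQ : z - latticePt n ∈ Q := by
      intro i
      have h3 : ⌊z i⌋ = n i := congrFun hzn i
      have h4 := Int.floor_le (z i)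
      have h5 := Int.lt_floor_add_one (z i)
      rw [h3] at h4 h5
      simp only [latticePt, PiLp.sub_apply, Set.mem_Icc]
      constructor <;> linarith
    obtain ⟨p, hp, hzp⟩ := Set.mem_iUnion₂.1 (hPc hzQ)
    have hp' : p ∈ hPf.toFinset := hPf.mem_toFinset.2 hp
    rw [ENNReal.le_div_iff_mul_le (Or.inl hV0) (Or.inl hVt)]
    refine (hz p hp' ?_).trans (Finset.single_le_sum (f := fun p =>
      ∫⁻ x in Metric.ball (p + latticePt n) (1 / 2), G x) (fun _ _ => zero_le) hp')
    rw [Metric.mem_ball, dist_eq_norm] at hzp ⊢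
    rwa [sub_sub, add_comm (latticePt n)] at hzp
  refine ne_top_of_le_ne_top ?_ (ENNReal.tsum_le_tsum hcube)
  simp_rw [div_eq_mul_inv]
  rw [ENNReal.tsum_mul_right, Summable.tsum_finsetSum fun _ _ => ENNReal.summable]
  refine ENNReal.mul_ne_top (ENNReal.sum_ne_top.2 fun p _ => ?_) (ENNReal.inv_ne_top.2 hV0)
  rw [← lintegral_iUnion fun _ => measurableSet_ball]
  · exact ((setLIntegral_le_lintegral _ _).trans_lt hfin).ne
  · intro a b hab
    refine Metric.ball_disjoint_ball ?_
    obtain ⟨i, hi⟩ := Function.ne_iff.1 hab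
    have h1 : ‖(latticePt a - latticePt b : E d) i‖ ≤ ‖(latticePt a - latticePt b : E d)‖ :=
      PiLp.norm_apply_le _ i
    have h2 : (1 : ℝ) ≤ |(a i : ℝ) - b i| := by
      exact_mod_cast Int.one_le_abs (sub_ne_zero.2 hi)
    rw [dist_add_left, dist_eq_norm]
    simp only [latticePt, PiLp.sub_apply, Real.norm_eq_abs] at h1
    simp only [latticePt]
    linarith

theorem synthBounded_of_memAmalgam {d : ℕ} {ψ : L2 d} (h : MemAmalgam ∞ 1 1 (ψ : E d → ℂ)) :
    SynthBounded ψ := by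
  set a : (Fin d → ℤ) → ℝ≥0∞ := fun n => eLpNormEssSup ψ (volume.restrict (cube n)) with ha
  refine ⟨(∑' n, a n) ^ 2, ENNReal.pow_ne_top (tsum_essSup_cube_ne_top h), fun c => ?_⟩
  refine le_trans (ENNReal.tsum_le_tsum fun n => ?_) (tsum_conv_sq_le a fun k => ‖c k‖ₑ)
  refine pow_le_pow_left' (essSup_cube_le ?_) 2
  have h1 : ∀ᵐ x, ∀ m, x ∈ cube m → ‖ψ x‖ₑ ≤ a m := ae_all_iff.2 fun m =>
    (ae_restrict_iff' (measurableSet_cube m)).1 ae_le_eLpNormEssSup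
  have h2 : ∀ᵐ x, ∀ k : Fin d → ℤ, ∀ m, x - latticePt k ∈ cube m → ‖ψ (x - latticePt k)‖ₑ ≤ a m :=
    ae_all_iff.2 fun k => ae_sub (latticePt k) h1
  filter_upwards [coeFn_synth ψ c, h2] with x hx h3 hxn
  rw [hx]
  calc ‖∑ k ∈ c.support, c k * ψ (x - latticePt k)‖ₑ
      ≤ ∑ k ∈ c.support, ‖c k * ψ (x - latticePt k)‖ₑ := enorm_sum_le _ _
    _ ≤ ∑ k ∈ c.support, a (n - k) * ‖c k‖ₑ := by
        refine Finset.sum_le_sum fun k _ => ?_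
        rw [enorm_mul, mul_comm]
        gcongr
        exact h3 k _ (by rw [mem_cube, floorPt_sub_latticePt, mem_cube.1 hxn])
    _ ≤ ∑' k, a (n - k) * ‖c k‖ₑ := ENNReal.sum_le_tsum _
    _ = ∑' k, a k * ‖c (n - k)‖ₑ := by
        rw [← (Equiv.subLeft n).tsum_eq (fun k => a (n - k) * ‖c k‖ₑ)]
        simp

/-! ### The Fourier transform on `L²` -/

theorem continuous_fourier_of_integrable {d : ℕ} {f : E d → ℂ} (hf : Integrable f) :
    Continuous (𝓕 f) :=
  VectorFourier.fourierIntegral_continuous Real.continuous_fourierChar continuous_inner hf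

theorem norm_fourier_le_integral {d : ℕ} (f : E d → ℂ) (ξ : E d) : ‖𝓕 f ξ‖ ≤ ∫ x, ‖f x‖ :=
  VectorFourier.norm_fourierIntegral_le_integral_norm _ _ _ _ _

/-- On `L¹ ∩ L²` the Plancherel transform is given by the Fourier integral. Both sides have the same
pairing with test functions, since the Fourier integral is self-adjoint. -/
theorem fourier_toLp_eq {d : ℕ} {f : E d → ℂ} (hf : Integrable f)
    (h2 : MemLp f 2 (volume : Measure (E d))) :
    (𝓕 (h2.toLp f) : L2 d) =ᵐ[volume] 𝓕 f := by
  refine ae_eq_of_integral_contDiff_smul_eq ((Lp.memLp _).locallyIntegrable one_le_two)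
    (continuous_fourier_of_integrable hf).locallyIntegrable ?_
  intro g g_smooth g_cpt
  have hg₁ : HasCompactSupport (Complex.ofRealCLM ∘ g) := g_cpt.comp_left rfl
  have hg₂ : ContDiff ℝ ((⊤ : ℕ∞) : WithTop ℕ∞) (Complex.ofRealCLM ∘ g) :=
    Complex.ofRealCLM.contDiff.comp g_smooth
  set χ : 𝓢(E d, ℂ) := hg₁.toSchwartzMap hg₂ with hχ
  have hχg : ∀ x, χ x = (g x : ℂ) := fun x => rfl
  have h1 : (𝓕 ((h2.toLp f : L2 d) : 𝓢'(E d, ℂ))) χ = ∫ x, χ x • (𝓕 (h2.toLp f) : L2 d) x := by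
    rw [Lp.fourier_toTemperedDistribution_eq, Lp.toTemperedDistribution_apply]
  rw [TemperedDistribution.fourier_apply, Lp.toTemperedDistribution_apply] at h1
  have h3 : ∫ x, (𝓕 χ) x • (h2.toLp f : L2 d) x = ∫ x, (𝓕 χ) x • f x := by
    refine integral_congr_ae ?_
    filter_upwards [h2.coeFn_toLp] with x hx
    rw [hx]
  have h4 : ∫ ξ, (𝓕 (χ : E d → ℂ)) ξ • f ξ = ∫ x, χ x • (𝓕 f) x := by
    have := VectorFourier.integral_fourierIntegral_smul_eq_flip (L := innerₗ (E d))
      (μ := volume) (ν := volume) Real.continuous_fourierChar continuous_inner χ.integrable hf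
    rwa [flip_innerₗ] at this
  have h5 : ∀ (u : E d → ℂ), ∫ x, g x • u x = ∫ x, χ x • u x := fun u => by
    refine integral_congr_ae (Filter.Eventually.of_forall fun x => ?_)
    simp [hχg]
  rw [h5, h5, ← h1, h3, ← h4]
  rfl

/-- Multiplication by an essentially bounded function, as an operator on `L²`. -/
def mulL2 {d : ℕ} {b : E d → ℂ} (hb : MemLp b ∞ (volume : Measure (E d))) : L2 d →L[ℂ] L2 d :=
  (ContinuousLinearMap.lsmul ℂ ℂ).holderL volume ∞ 2 2 (hb.toLp b)

theorem coeFn_mulL2 {d : ℕ} {b : E d → ℂ} (hb : MemLp b ∞ (volume : Measure (E d))) (f : L2 d) :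
    mulL2 hb f =ᵐ[volume] fun x => b x * f x := by
  have h := (ContinuousLinearMap.lsmul ℂ ℂ : ℂ →L[ℂ] ℂ →L[ℂ] ℂ).coeFn_holder (r := 2)
    (hb.toLp b) f
  filter_upwards [h, hb.coeFn_toLp] with x h1 h2
  rw [mulL2]
  rw [h2] at h1
  exact h1

/-- The character `ξ ↦ e^{-2π i k·ξ}` by which translation by `k` acts on the Fourier side. -/
def char {d : ℕ} (k : Fin d → ℤ) (ξ : E d) : ℂ :=
  UnitAddTorus.mFourier (-k) (fun i => (ξ i : UnitAddCircle))

theorem char_eq {d : ℕ} (k : Fin d → ℤ) (ξ : E d) :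
    char k ξ = (Real.fourierChar (inner ℝ (-latticePt k) ξ) : ℂ) := by
  rw [Real.fourierChar_apply, char]
  simp only [UnitAddTorus.mFourier, ContinuousMap.coe_mk, fourier_coe_apply, ← Complex.exp_sum]
  congr 1
  simp only [PiLp.inner_apply, latticePt, PiLp.neg_apply, Complex.ofReal_mul, Complex.ofReal_sum,
    Finset.mul_sum, Finset.sum_mul]
  refine Finset.sum_congr rfl fun i _ => ?_
  simp
  ring

theorem norm_char {d : ℕ} (k : Fin d → ℤ) (ξ : E d) : ‖char k ξ‖ = 1 := by
  rw [char_eq, Circle.norm_coe]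

theorem continuous_char {d : ℕ} (k : Fin d → ℤ) : Continuous (char k : E d → ℂ) := by
  have : (char k : E d → ℂ) = fun ξ => (Real.fourierChar (inner ℝ (-latticePt k) ξ) : ℂ) :=
    funext (char_eq k)
  rw [this]
  exact continuous_subtype_val.comp (Real.continuous_fourierChar.comp (by fun_prop))

theorem char_sub_latticePt {d : ℕ} (k n : Fin d → ℤ) (ξ : E d) :
    char k (ξ - latticePt n) = char k ξ := by
  rw [char, char]
  congr 1
  ext i
  simp [latticePt]

theorem memLp_char {d : ℕ} (k : Fin d → ℤ) :
    MemLp (char k : E d → ℂ) ∞ (volume : Measure (E d)) :=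
  memLp_top_of_bound (continuous_char k).aestronglyMeasurable 1
    (Filter.Eventually.of_forall fun ξ => (norm_char k ξ).le)

/-- Translation becomes multiplication by a character; it suffices to check this on the dense
subspace of Schwartz functions. -/
theorem fourier_shift {d : ℕ} (k : Fin d → ℤ) (φ : L2 d) :
    𝓕 (shift one_pos k φ) = mulL2 (memLp_char k) (𝓕 φ) := by
  refine DenseRange.induction_on (p := fun φ : L2 d =>
    𝓕 (shift one_pos k φ) = mulL2 (memLp_char k) (𝓕 φ))
    (SchwartzMap.denseRange_toLpCLM (E := E d) (F := ℂ) (p := 2) (μ := volume)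
      ENNReal.ofNat_ne_top) φ ?_ ?_
  · refine isClosed_eq ?_ ?_
    · exact (Lp.fourierTransformₗᵢ (E d) ℂ).continuous.comp (shift one_pos k).continuous
    · exact (mulL2 (memLp_char k)).continuous.comp (Lp.fourierTransformₗᵢ (E d) ℂ).continuous
  · intro u
    rw [SchwartzMap.toLpCLM_apply]
    set v : E d → ℂ := fun x => u (x + -latticePt k) with hv
    have hvi : Integrable v := u.integrable.comp_add_right _
    have hv2 : MemLp v 2 (volume : Measure (E d)) :=
      (u.memLp 2).comp_measurePreserving (measurePreserving_add_right volume (-latticePt k))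
    have h1 : shift one_pos k (u.toLp 2) = hv2.toLp v := by
      refine Lp.ext ?_
      filter_upwards [coeFn_shift_one k (u.toLp 2), hv2.coeFn_toLp,
        ae_sub (latticePt k) (p := fun y => (u.toLp 2 volume : L2 d) y = u y)
          (u.coeFn_toLp 2 volume)] with x h2 h3 h4
      rw [h2, h3, h4, hv]
      simp [sub_eq_add_neg]
    rw [h1]
    refine Lp.ext ?_
    filter_upwards [fourier_toLp_eq hvi hv2, coeFn_mulL2 (memLp_char k) (𝓕 (u.toLp 2) : L2 d),
      (𝓕 u).coeFn_toLp 2] with ξ h2 h3 h4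
    rw [h2, h3, SchwartzMap.toLp_fourier_eq, h4, char_eq]
    exact congrFun (VectorFourier.fourierIntegral_comp_add_right Real.fourierChar volume
      (innerₗ (E d)) u (-latticePt k)) ξ

/-- The trigonometric polynomial `∑ₖ cₖ e^{-2π i k·ξ}`. -/
def trigPoly {d : ℕ} (c : (Fin d → ℤ) →₀ ℂ) (ξ : E d) : ℂ := ∑ k ∈ c.support, c k * char k ξ

theorem continuous_trigPoly {d : ℕ} (c : (Fin d → ℤ) →₀ ℂ) :
    Continuous (trigPoly c : E d → ℂ) :=
  continuous_finsetSum _ fun k _ => continuous_const.mul (continuous_char k)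

theorem fourier_synth {d : ℕ} (φ : L2 d) (c : (Fin d → ℤ) →₀ ℂ) :
    (𝓕 (synth φ c) : L2 d) =ᵐ[volume] fun ξ => trigPoly c ξ * (𝓕 φ : L2 d) ξ := by
  have h0 : 𝓕 (synth φ c) = ∑ k ∈ c.support, c k • mulL2 (memLp_char k) (𝓕 φ : L2 d) := by
    rw [synth_eq]
    change Lp.fourierTransformₗᵢ (E d) ℂ _ = _
    rw [map_sum]
    refine Finset.sum_congr rfl fun k _ => ?_
    rw [map_smul, ← fourier_shift]
    rfl
  rw [h0]
  have h1 : ∀ k ∈ c.support, ∀ᵐ ξ, (c k • mulL2 (memLp_char k) (𝓕 φ : L2 d) : L2 d) ξ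
      = c k * char k ξ * (𝓕 φ : L2 d) ξ := fun k _ => by
    filter_upwards [Lp.coeFn_smul (c k) (mulL2 (memLp_char k) (𝓕 φ : L2 d)),
      coeFn_mulL2 (memLp_char k) (𝓕 φ : L2 d)] with x h2 h3
    rw [h2, Pi.smul_apply, h3, smul_eq_mul, mul_assoc]
  filter_upwards [coeFn_sum c.support fun k => c k • mulL2 (memLp_char k) (𝓕 φ : L2 d),
    (Finset.eventually_all _).2 h1] with x h2 h3
  rw [h2, Finset.sum_congr rfl h3, trigPoly, Finset.sum_mul]

/-! ### Periodization -/

theorem setLIntegral_cube {d : ℕ} (F : E d → ℝ≥0∞) (n : Fin d → ℤ) :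
    ∫⁻ x in cube n, F x = ∫⁻ x in cube 0, F (x + latticePt n) := by
  rw [← lintegral_indicator (measurableSet_cube n), ← lintegral_indicator (measurableSet_cube 0),
    ← lintegral_add_right_eq_self _ (latticePt n)]
  congr 1
  ext x
  simp only [Set.indicator, mem_cube, floorPt_add_latticePt, add_eq_right]

theorem lintegral_eq_periodization {d : ℕ} {F : E d → ℝ≥0∞} (hF : AEMeasurable F) :
    ∫⁻ x, F x = ∫⁻ x in cube 0, ∑' n : Fin d → ℤ, F (x - latticePt n) := by
  have hneg : ∀ n : Fin d → ℤ, (latticePt (-n) : E d) = -latticePt n := fun n => by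
    ext i; simp [latticePt]
  rw [lintegral_eq_tsum_cube, lintegral_tsum, ← (Equiv.neg _).tsum_eq]
  · simp_rw [setLIntegral_cube F, Equiv.neg_apply, hneg, ← sub_eq_add_neg]
  · exact fun n => (hF.comp_quasiMeasurePreserving
      (measurePreserving_sub_right volume (latticePt n)).quasiMeasurePreserving).restrict

section Torus

-- the probability measure on the circle for which `UnitAddTorus.lintegral_preimage` and
-- `UnitAddTorus.orthonormal_mFourier` are stated
attribute [local instance] instMeasureSpaceUnitAddCircle

theorem setLIntegral_cube_zero_eq_torus {d : ℕ} (F : UnitAddTorus (Fin d) → ℝ≥0∞) :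
    ∫⁻ x : E d in cube 0, F (fun i => (x i : UnitAddCircle)) = ∫⁻ t, F t := by
  rw [UnitAddTorus.lintegral_preimage F 0]
  have h1 : (cube 0 : Set (E d)) = (WithLp.ofLp (p := 2) (V := Fin d → ℝ)) ⁻¹'
      (Set.univ.pi fun _ => Set.Ico 0 1) := by
    ext x
    rw [mem_cube, funext_iff]
    simp [floorPt, Int.floor_eq_zero_iff]
  have h2 : {x : Fin d → ℝ | ∀ i, x i ∈ Set.Ioc ((0 : Fin d → ℝ) i) ((0 : Fin d → ℝ) i + 1)}
      = Set.univ.pi fun _ => Set.Ioc 0 1 := by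
    ext x; simp
  have h3 : (Set.univ.pi fun _ : Fin d => Set.Ico (0 : ℝ) 1) =ᵐ[volume]
      Set.univ.pi fun _ => Set.Ioc 0 1 :=
    Measure.univ_pi_Ico_ae_eq_Icc.trans Measure.univ_pi_Ioc_ae_eq_Icc.symm
  rw [h2, ← setLIntegral_congr h3, h1]
  exact (PiLp.volume_preserving_ofLp (Fin d)).setLIntegral_comp_preimage_emb
    (MeasurableEquiv.toLp 2 (Fin d → ℝ)).symm.measurableEmbedding
    (fun y : Fin d → ℝ => F (fun i => (y i : UnitAddCircle))) _

/-- Parseval's identity for trigonometric polynomials. -/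
theorem lintegral_trigPoly {d : ℕ} (c : (Fin d → ℤ) →₀ ℂ) :
    ∫⁻ ξ : E d in cube 0, ‖trigPoly c ξ‖ₑ ^ 2 = ∑' k, ‖c k‖ₑ ^ 2 := by
  have h1 := setLIntegral_cube_zero_eq_torus (d := d)
    fun t => ‖∑ k ∈ c.support, c k * UnitAddTorus.mFourier (-k) t‖ₑ ^ 2
  refine h1.trans ?_
  set v : (Fin d → ℤ) → Lp ℂ 2 (volume : Measure (UnitAddTorus (Fin d))) :=
    fun k => UnitAddTorus.mFourierLp 2 (-k) with hv
  have hv' : Orthonormal ℂ v :=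
    UnitAddTorus.orthonormal_mFourier.comp _ neg_injective
  set w := ∑ k ∈ c.support, c k • v k with hw
  have h2 : ‖w‖ₑ ^ 2 = ∫⁻ t, ‖∑ k ∈ c.support, c k * UnitAddTorus.mFourier (-k) t‖ₑ ^ 2 := by
    rw [Lp.enorm_def, eLpNorm_two_sq]
    refine lintegral_congr_ae ?_
    have h3 : ∀ k ∈ c.support, ∀ᵐ t, (c k • v k : Lp ℂ 2 volume) t
        = c k * UnitAddTorus.mFourier (-k) t := fun k _ => by
      filter_upwards [Lp.coeFn_smul (c k) (v k), UnitAddTorus.coeFn_mFourierLp 2 (-k)]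
        with t h4 h5
      rw [h4, Pi.smul_apply, h5, smul_eq_mul]
    filter_upwards [coeFn_sum c.support fun k => c k • v k, (Finset.eventually_all _).2 h3]
      with t h4 h5
    rw [h4, Finset.sum_congr rfl h5]
  rw [← h2]
  have h6 : ‖w‖ ^ 2 = ∑ k ∈ c.support, ‖c k‖ ^ 2 := by
    have h7 := hv'.inner_sum c c c.support
    rw [← hw, inner_self_eq_norm_sq_to_K] at h7
    have h8 : ∀ k, (starRingEnd ℂ) (c k) * c k = ((‖c k‖ ^ 2 : ℝ) : ℂ) := fun k => by
      rw [RCLike.conj_mul]; norm_cast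
    simp_rw [h8] at h7
    rw [← Complex.ofReal_inj, Complex.ofReal_sum, Complex.ofReal_pow]
    exact h7
  rw [tsum_eq_sum (s := c.support) (by simp), ← ofReal_norm, ← ENNReal.ofReal_pow (norm_nonneg _),
    h6, ENNReal.ofReal_sum_of_nonneg fun _ _ => by positivity]
  simp_rw [ENNReal.ofReal_pow (norm_nonneg _), ofReal_norm]

end Torus

/-- The periodization `∑ₖ |φ̂(ξ - k)|²`. -/
def periodization {d : ℕ} (φ : L2 d) (ξ : E d) : ℝ≥0∞ :=
  ∑' k : Fin d → ℤ, ‖(𝓕 φ : L2 d) (ξ - latticePt k)‖ₑ ^ 2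

/-- Plancherel's identity for finite combinations of lattice translates: the Fourier transform is
the product of a periodic trigonometric polynomial and `φ̂`. -/
theorem enorm_synth_sq {d : ℕ} (φ : L2 d) (c : (Fin d → ℤ) →₀ ℂ) :
    ‖synth φ c‖ₑ ^ 2 = ∫⁻ ξ in cube 0, ‖trigPoly c ξ‖ₑ ^ 2 * periodization φ ξ := by
  have h1 : ‖synth φ c‖ₑ = ‖(𝓕 (synth φ c) : L2 d)‖ₑ := by
    rw [enorm_eq_iff_norm_eq, Lp.norm_fourier_eq]
  rw [h1, enorm_sq_eq_lintegral]
  have h2 : ∫⁻ ξ, ‖(𝓕 (synth φ c) : L2 d) ξ‖ₑ ^ 2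
      = ∫⁻ ξ, ‖trigPoly c ξ‖ₑ ^ 2 * ‖(𝓕 φ : L2 d) ξ‖ₑ ^ 2 := by
    refine lintegral_congr_ae ?_
    filter_upwards [fourier_synth φ c] with ξ hξ
    rw [hξ, enorm_mul, mul_pow]
  rw [h2, lintegral_eq_periodization]
  · simp_rw [periodization, ← ENNReal.tsum_mul_left, trigPoly, char_sub_latticePt]
  · exact ((continuous_trigPoly c).aestronglyMeasurable.enorm.pow_const 2).mul
      ((Lp.aestronglyMeasurable _).enorm.pow_const 2)

theorem enorm_synth_sq_le {d : ℕ} {φ : L2 d} {B : ℝ≥0∞} (hB : B ≠ ∞)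
    (h : ∀ᵐ ξ : E d, ξ ∈ cube 0 → periodization φ ξ ≤ B)
    (c : (Fin d → ℤ) →₀ ℂ) : ‖synth φ c‖ₑ ^ 2 ≤ B * ∑' k, ‖c k‖ₑ ^ 2 := by
  rw [enorm_synth_sq, ← lintegral_trigPoly, ← lintegral_const_mul' _ _ hB]
  refine lintegral_mono_ae ?_
  filter_upwards [(ae_restrict_iff' (measurableSet_cube 0)).2 h] with ξ hξ
  rw [mul_comm]
  gcongr

theorem mul_tsum_le_enorm_synth_sq {d : ℕ} {φ : L2 d} {A : ℝ≥0∞} (hA : A ≠ ∞)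
    (h : ∀ᵐ ξ : E d, A ≤ periodization φ ξ)
    (c : (Fin d → ℤ) →₀ ℂ) : A * ∑' k, ‖c k‖ₑ ^ 2 ≤ ‖synth φ c‖ₑ ^ 2 := by
  rw [enorm_synth_sq, ← lintegral_trigPoly, ← lintegral_const_mul' _ _ hA]
  refine lintegral_mono_ae ?_
  filter_upwards [ae_restrict_of_ae h] with ξ hξ
  rw [mul_comm]
  gcongr

theorem ae_two_pi_smul {d : ℕ} {p : E d → Prop} (h : ∀ᵐ ω, p ω) :
    ∀ᵐ ξ : E d, p ((2 * Real.pi) • ξ) := by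
  simpa using ae_affine (s := (2 * Real.pi)⁻¹) (by positivity) (0 : E d) h

/-- In the variable `ξ = ω/(2π)` the lattice `2πℤ^d` becomes `ℤ^d`. -/
theorem fourierAng_two_pi_smul {d : ℕ} (φ : L2 d) (ξ : E d) (k : Fin d → ℤ) :
    fourierAng φ ((2 * Real.pi) • ξ - (2 * Real.pi) • latticePt k)
      = (𝓕 φ : L2 d) (ξ - latticePt k) := by
  rw [fourierAng, ← smul_sub, smul_smul, inv_mul_cancel₀ (by positivity), one_smul]

theorem RieszCondition.exists_le_periodization {d : ℕ} {φ : L2 d} (h : RieszCondition φ) :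
    ∃ A : ℝ≥0∞, A ≠ 0 ∧ A ≠ ∞ ∧ ∀ᵐ ξ : E d, A ≤ periodization φ ξ := by
  obtain ⟨A, B, hA, -, hAB⟩ := h
  refine ⟨ENNReal.ofReal A, by simpa using hA, ENNReal.ofReal_ne_top, ?_⟩
  filter_upwards [ae_two_pi_smul hAB] with ξ hξ
  simp_rw [fourierAng_two_pi_smul] at hξ
  exact hξ.1

/-! ### The one-dimensional gamma kernel -/

/-- The measure `t^{α-1} dt` on the positive half-line. -/
def powMeasure (α : ℝ) : Measure ℝ :=
  (volume.restrict (Set.Ioi 0)).withDensity fun t => ENNReal.ofReal (t ^ (α - 1))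

theorem integral_powMeasure {V : Type*} [NormedAddCommGroup V] [NormedSpace ℝ V] (α : ℝ)
    (f : ℝ → V) : ∫ t, f t ∂powMeasure α = ∫ t in Set.Ioi 0, t ^ (α - 1) • f t := by
  rw [powMeasure, integral_withDensity_eq_integral_toReal_smul (by fun_prop) (by simp)]
  refine setIntegral_congr_fun measurableSet_Ioi fun t ht => ?_
  have ht' : (0 : ℝ) < t := ht
  simp only [ENNReal.toReal_ofReal (Real.rpow_nonneg ht'.le _)]

theorem integral_exp_powMeasure {α r : ℝ} (hα : 0 < α) (hr : 0 < r) :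
    ∫ t, Real.exp (-r * t) ∂powMeasure α = (1 / r) ^ α * Real.Gamma α := by
  rw [integral_powMeasure, ← Real.integral_rpow_mul_exp_neg_mul_Ioi hα hr]
  simp

theorem Iio_subset_integrableExpSet {α : ℝ} (hα : 0 < α) :
    Set.Iio 0 ⊆ ProbabilityTheory.integrableExpSet id (powMeasure α) := by
  intro r hr
  have hr' : 0 < -r := by simpa using hr
  refine Integrable.of_integral_ne_zero ?_
  have h := integral_exp_powMeasure hα hr'
  rw [neg_neg] at h
  simp only [id]
  rw [h]
  have := Real.Gamma_pos_of_pos hα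
  positivity

/-- The Laplace transform of `t^{α-1}` in the right half-plane; by analytic continuation it is
determined by its values for real arguments. -/
theorem complexMGF_powMeasure {α : ℝ} (hα : 0 < α) {z : ℂ} (hz : z.re < 0) :
    ProbabilityTheory.complexMGF id (powMeasure α) z
      = (Real.Gamma α : ℂ) * (-z) ^ (-(α : ℂ)) := by
  set U : Set ℂ := {z : ℂ | z.re < 0} with hU
  have hUo : IsOpen U := isOpen_lt Complex.continuous_re continuous_const
  have hUc : IsPreconnected U := (convex_halfSpace_re_lt 0).isPreconnected
  have hf : AnalyticOnNhd ℂ (ProbabilityTheory.complexMGF id (powMeasure α)) U := by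
    intro w hw
    refine ProbabilityTheory.analyticAt_complexMGF ?_
    exact interior_mono (Iio_subset_integrableExpSet hα) (by rw [interior_Iio]; exact hw)
  have hg : AnalyticOnNhd ℂ (fun z : ℂ => (Real.Gamma α : ℂ) * (-z) ^ (-(α : ℂ))) U := by
    intro w hw
    refine analyticAt_const.mul ((analyticAt_id.neg).cpow analyticAt_const ?_)
    refine Complex.mem_slitPlane_iff.2 (Or.inl ?_)
    have : w.re < 0 := hw
    simpa using this
  have hreal : ∀ r : ℝ, 0 < r → ProbabilityTheory.complexMGF id (powMeasure α) ((-r : ℝ) : ℂ)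
      = (Real.Gamma α : ℂ) * (-((-r : ℝ) : ℂ)) ^ (-(α : ℂ)) := by
    intro r hr
    rw [ProbabilityTheory.complexMGF_ofReal, ProbabilityTheory.mgf]
    simp only [id]
    rw [integral_exp_powMeasure hα hr, one_div, Real.inv_rpow hr.le, ← Real.rpow_neg hr.le]
    rw [Complex.ofReal_mul, Complex.ofReal_cpow hr.le]
    push_cast
    rw [neg_neg, mul_comm]
  refine AnalyticOnNhd.eqOn_of_preconnected_of_frequently_eq hf hg hUc (z₀ := -1)
    (by simp [hU]) ?_ hz
  -- the real points `-(1 + 1/(n+1))` accumulate at `-1`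
  have ht : Filter.Tendsto (fun n : ℕ => ((-(1 + 1 / ((n : ℝ) + 1)) : ℝ) : ℂ)) Filter.atTop
      (nhdsWithin (-1) {-1}ᶜ) := by
    refine tendsto_nhdsWithin_iff.2 ⟨?_, Filter.Eventually.of_forall fun n => ?_⟩
    · have h1 := (tendsto_one_div_add_atTop_nhds_zero_nat (𝕜 := ℝ)).const_add 1 |>.neg
      have h2 := (Complex.continuous_ofReal.tendsto _).comp h1
      simpa [Function.comp_def] using h2
    · have h3 : (0 : ℝ) < 1 / ((n : ℝ) + 1) := by positivity
      intro h4
      have h5 := congrArg Complex.re (Set.mem_singleton_iff.1 h4)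
      rw [Complex.ofReal_re] at h5
      simp only [Complex.neg_re, Complex.one_re] at h5
      linarith
  exact ht.frequently (Filter.Frequently.of_forall fun n => hreal _ (by positivity))

/-- The gamma density `t_+^{α-1} e^{-t}`. -/
def gammaKernel₁ (α t : ℝ) : ℝ := (Set.Ioi 0).indicator (fun t => t ^ (α - 1) * Real.exp (-t)) t

theorem gammaKernel₁_nonneg (α t : ℝ) : 0 ≤ gammaKernel₁ α t :=
  Set.indicator_nonneg (fun t ht => by have : (0:ℝ) < t := ht; positivity) t

theorem integrable_gammaKernel₁ {α : ℝ} (hα : 0 < α) : Integrable (gammaKernel₁ α) := by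
  have h := Real.GammaIntegral_convergent hα
  have h1 : gammaKernel₁ α = (Set.Ioi 0).indicator (fun t => Real.exp (-t) * t ^ (α - 1)) := by
    funext t
    simp only [gammaKernel₁, mul_comm]
  rw [h1]
  exact (integrable_indicator_iff measurableSet_Ioi).2 h

/-- The Fourier transform of the gamma density is `Γ(α) (1 + 2π i x)^{-α}`. -/
theorem norm_fourier_gammaKernel₁ {α : ℝ} (hα : 0 < α) (x : ℝ) :
    ‖∫ t, (Real.fourierChar (-(t * x)) : ℂ) * (gammaKernel₁ α t : ℂ)‖
      = Real.Gamma α * Real.sqrt (1 + (2 * Real.pi * x) ^ 2) ^ (-α) := by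
  set z : ℂ := -(1 + (2 * Real.pi * x : ℝ) * Complex.I) with hz
  have h1 : ∫ t, (Real.fourierChar (-(t * x)) : ℂ) * (gammaKernel₁ α t : ℂ)
      = ProbabilityTheory.complexMGF id (powMeasure α) z := by
    rw [ProbabilityTheory.complexMGF, integral_powMeasure, ← integral_indicator measurableSet_Ioi]
    refine integral_congr_ae (Filter.Eventually.of_forall fun t => ?_)
    by_cases ht : t ∈ Set.Ioi (0 : ℝ)
    · simp only [gammaKernel₁, Set.indicator_of_mem ht, Real.fourierChar_apply, id, hz]
      rw [Complex.real_smul, Complex.ofReal_mul (t ^ (α - 1)), Complex.ofReal_exp, mul_comm,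
        mul_assoc, ← Complex.exp_add]
      congr 2
      push_cast
      ring
    · simp only [gammaKernel₁, Set.indicator_of_notMem ht, Complex.ofReal_zero, mul_zero]
  have hzre : z.re < 0 := by simp [hz]
  rw [h1, complexMGF_powMeasure hα hzre, norm_mul, ← Complex.ofReal_neg, Complex.norm_cpow_real,
    Complex.norm_real, Real.norm_of_nonneg (Real.Gamma_pos_of_pos hα).le, hz, neg_neg,
    ← Complex.ofReal_one, Complex.norm_add_mul_I]
  norm_num

/-! ### The kernel on `ℝ^d` -/

/-- The tensor product `∏ᵢ (yᵢ)_+^{α-1} e^{-yᵢ}` of gamma densities. The modulus of its Fourier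
transform is a multiple of `v^{-α}`. -/
def gammaKernel {d : ℕ} (α : ℝ) (y : E d) : ℂ := ∏ i, (gammaKernel₁ α (y i) : ℂ)

theorem integral_prod_ofLp {d : ℕ} {𝕜 : Type*} [RCLike 𝕜] (f : Fin d → ℝ → 𝕜) :
    ∫ y : E d, ∏ i, f i (y i) = ∏ i, ∫ t, f i t := by
  rw [← integral_fintype_prod_volume_eq_prod]
  exact (PiLp.volume_preserving_ofLp (Fin d)).integral_comp
    (MeasurableEquiv.toLp 2 (Fin d → ℝ)).symm.measurableEmbedding
    (fun y : Fin d → ℝ => ∏ i, f i (y i))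

theorem integrable_prod_ofLp {d : ℕ} {𝕜 : Type*} [RCLike 𝕜] {f : Fin d → ℝ → 𝕜}
    (hf : ∀ i, Integrable (f i)) : Integrable fun y : E d => ∏ i, f i (y i) := by
  have h : Integrable (fun y : Fin d → ℝ => ∏ i, f i (y i)) :=
    Integrable.fintype_prod (μ := fun _ => volume) hf
  exact ((PiLp.volume_preserving_ofLp (Fin d)).integrable_comp_emb
    (MeasurableEquiv.toLp 2 (Fin d → ℝ)).symm.measurableEmbedding).2 h

theorem integrable_gammaKernel {d : ℕ} {α : ℝ} (hα : 0 < α) :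
    Integrable (gammaKernel α : E d → ℂ) :=
  integrable_prod_ofLp fun _ => (integrable_gammaKernel₁ hα).ofReal

theorem norm_fourier_gammaKernel {d : ℕ} {α : ℝ} (hα : 0 < α) (ξ : E d) :
    ‖𝓕 (gammaKernel α : E d → ℂ) ξ‖
      = Real.Gamma α ^ d * weight ((2 * Real.pi) • ξ) ^ (-α) := by
  have h1 : 𝓕 (gammaKernel α : E d → ℂ) ξ
      = ∏ i, ∫ t, (Real.fourierChar (-(t * ξ i)) : ℂ) * (gammaKernel₁ α t : ℂ) := by
    rw [Real.fourier_eq, ← integral_prod_ofLp]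
    refine integral_congr_ae (Filter.Eventually.of_forall fun y => ?_)
    simp only [Finset.prod_mul_distrib, gammaKernel, Circle.smul_def, smul_eq_mul]
    congr 1
    simp only [Real.fourierChar_apply, ← Complex.exp_sum, PiLp.inner_apply]
    congr 1
    rw [← Finset.sum_mul, ← Complex.ofReal_sum, ← Finset.mul_sum, Finset.sum_neg_distrib]
    simp [mul_comm]
  rw [h1, norm_prod]
  simp_rw [norm_fourier_gammaKernel₁ hα]
  rw [Finset.prod_mul_distrib, Finset.prod_const, Finset.card_univ, Fintype.card_fin, weight,
    ← Real.finsetProd_rpow _ _ fun _ _ => Real.sqrt_nonneg _]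
  simp

/-! ### Summability of the local `L²` norms of the kernel -/

theorem integral_gammaKernel₁_sq_le {α : ℝ} (hα : 1 / 2 < α) (m : ℤ) :
    Integrable ((Set.Ico (m : ℝ) (m + 1)).indicator fun t => gammaKernel₁ α t ^ 2) ∧
    ∫ t, (Set.Ico (m : ℝ) (m + 1)).indicator (fun t => gammaKernel₁ α t ^ 2) t
      ≤ Real.exp (-|(m : ℝ)|) * Real.Gamma (2 * α - 1) := by
  have hβ : 0 < 2 * α - 1 := by linarith
  have hint := integrable_gammaKernel₁ hβ
  have hΓ : ∫ t, gammaKernel₁ (2 * α - 1) t = Real.Gamma (2 * α - 1) := by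
    rw [Real.Gamma_eq_integral hβ]
    simp only [gammaKernel₁]
    rw [integral_indicator measurableSet_Ioi]
    simp only [mul_comm]
  -- on `[m, m+1)` half of the exponential decay of the square is at most `e^{-m}`
  have hle : ∀ t, (Set.Ico (m : ℝ) (m + 1)).indicator (fun t => gammaKernel₁ α t ^ 2) t
      ≤ Real.exp (-|(m : ℝ)|) * gammaKernel₁ (2 * α - 1) t := by
    intro t
    have h0 := gammaKernel₁_nonneg (2 * α - 1) t
    by_cases hm : t ∈ Set.Ico (m : ℝ) (m + 1)
    · rw [Set.indicator_of_mem hm]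
      by_cases ht : t ∈ Set.Ioi (0 : ℝ)
      · have ht' : (0 : ℝ) < t := ht
        have hm0 : 0 ≤ m := by
          have h1 : (0 : ℝ) < m + 1 := ht'.trans hm.2
          have h2 : (0 : ℤ) < m + 1 := by exact_mod_cast h1
          omega
        have hm0' : (0 : ℝ) ≤ m := by exact_mod_cast hm0
        simp only [gammaKernel₁, Set.indicator_of_mem ht]
        rw [abs_of_nonneg hm0', mul_pow, ← Real.rpow_natCast, ← Real.rpow_mul ht'.le,
          ← Real.exp_nat_mul]
        have h3 : (α - 1) * ((2 : ℕ) : ℝ) = 2 * α - 1 - 1 := by push_cast; ring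
        rw [h3, mul_left_comm, ← Real.exp_add]
        gcongr
        push_cast
        linarith [hm.1]
      · simp only [gammaKernel₁, Set.indicator_of_notMem ht]
        simp
    · rw [Set.indicator_of_notMem hm]
      positivity
  have hnn : ∀ t, 0 ≤ (Set.Ico (m : ℝ) (m + 1)).indicator (fun t => gammaKernel₁ α t ^ 2) t :=
    Set.indicator_nonneg fun t _ => sq_nonneg _
  have hmeas : Measurable (gammaKernel₁ α) :=
    Measurable.indicator (by fun_prop) measurableSet_Ioi
  have hI : Integrable ((Set.Ico (m : ℝ) (m + 1)).indicator fun t => gammaKernel₁ α t ^ 2) := by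
    refine Integrable.mono' (hint.const_mul (Real.exp (-|(m : ℝ)|)))
      ((hmeas.pow_const 2).indicator measurableSet_Ico).aestronglyMeasurable
      (Filter.Eventually.of_forall fun t => ?_)
    rw [Real.norm_of_nonneg (hnn t)]
    exact hle t
  refine ⟨hI, ?_⟩
  rw [← hΓ, ← integral_const_mul]
  exact integral_mono hI (hint.const_mul _) hle

/-- The condition `α > 1/2` makes the gamma kernel locally square integrable at the origin, and the
exponential factor gives the decay in `m`. -/
theorem lintegral_cube_gammaKernel_sq_le {d : ℕ} {α : ℝ} (hα : 1 / 2 < α) (m : Fin d → ℤ) :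
    ∫⁻ y in cube m, ‖(gammaKernel α y : ℂ)‖ₑ ^ 2
      ≤ ∏ i, ENNReal.ofReal (Real.exp (-|(m i : ℝ)|) * Real.Gamma (2 * α - 1)) := by
  have h1 : ∫⁻ y in cube m, ‖(gammaKernel α y : ℂ)‖ₑ ^ 2
      = ∫⁻ y : E d, ENNReal.ofReal (∏ i,
        (Set.Ico (m i : ℝ) (m i + 1)).indicator (fun t => gammaKernel₁ α t ^ 2) (y i)) := by
    rw [← lintegral_indicator (measurableSet_cube m)]
    refine lintegral_congr fun y => ?_
    by_cases hy : y ∈ cube m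
    · have h2 : ∀ i, y i ∈ Set.Ico (m i : ℝ) (m i + 1) := fun i => by
        rw [← mem_cube.1 hy]
        exact ⟨Int.floor_le _, Int.lt_floor_add_one _⟩
      rw [Set.indicator_of_mem hy, ← ofReal_norm, ← ENNReal.ofReal_pow (norm_nonneg _)]
      congr 1
      rw [gammaKernel, norm_prod, ← Finset.prod_pow]
      refine Finset.prod_congr rfl fun i _ => ?_
      rw [Set.indicator_of_mem (h2 i), Complex.norm_real,
        Real.norm_of_nonneg (gammaKernel₁_nonneg _ _)]
    · obtain ⟨i, hi⟩ := Function.ne_iff.1 (fun h => hy (mem_cube.2 h) : floorPt y ≠ m)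
      have h2 : y i ∉ Set.Ico (m i : ℝ) (m i + 1) := fun h => hi (Int.floor_eq_iff.2 h)
      rw [Set.indicator_of_notMem hy, Finset.prod_eq_zero (Finset.mem_univ i)
        (Set.indicator_of_notMem h2 _), ENNReal.ofReal_zero]
  have hnn : ∀ (n : ℤ) t, 0 ≤ (Set.Ico (n : ℝ) (n + 1)).indicator
      (fun t => gammaKernel₁ α t ^ 2) t := fun n =>
    Set.indicator_nonneg fun t _ => sq_nonneg _
  rw [h1, ← ofReal_integral_eq_lintegral_ofReal
    (integrable_prod_ofLp (f := fun i => (Set.Ico (m i : ℝ) (m i + 1)).indicator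
      fun t => gammaKernel₁ α t ^ 2) fun i => (integral_gammaKernel₁_sq_le hα (m i)).1)
    (Filter.Eventually.of_forall fun y => Finset.prod_nonneg fun i _ => hnn _ _),
    integral_prod_ofLp (fun i => (Set.Ico (m i : ℝ) (m i + 1)).indicator
      fun t => gammaKernel₁ α t ^ 2),
    ENNReal.ofReal_prod_of_nonneg fun i _ => integral_nonneg (hnn _)]
  exact Finset.prod_le_prod' fun i _ =>
    ENNReal.ofReal_le_ofReal (integral_gammaKernel₁_sq_le hα (m i)).2

/-- Any finite subset of `ℤ^d` is contained in a finite product set. -/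
theorem tsum_pi_prod_le {d : ℕ} (a : ℤ → ℝ≥0∞) :
    ∑' m : Fin d → ℤ, ∏ i, a (m i) ≤ (∑' k, a k) ^ d := by
  classical
  rw [ENNReal.tsum_eq_iSup_sum]
  refine iSup_le fun s => ?_
  set t : Fin d → Finset ℤ := fun i => s.image fun m => m i
  calc ∑ m ∈ s, ∏ i, a (m i) ≤ ∑ m ∈ Fintype.piFinset t, ∏ i, a (m i) := by
        refine Finset.sum_le_sum_of_subset fun m hm => ?_
        exact Fintype.mem_piFinset.2 fun i => Finset.mem_image_of_mem _ hm
    _ = ∏ i, ∑ k ∈ t i, a k := (Finset.prod_univ_sum t fun _ k => a k).symm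
    _ ≤ ∏ _i : Fin d, ∑' k, a k := Finset.prod_le_prod' fun i _ => ENNReal.sum_le_tsum _
    _ = _ := by simp

theorem tsum_sqrt_lintegral_gammaKernel_ne_top {d : ℕ} {α : ℝ} (hα : 1 / 2 < α) :
    ∑' m : Fin d → ℤ, (∫⁻ y in cube m, ‖(gammaKernel α y : ℂ)‖ₑ ^ 2) ^ (1 / 2 : ℝ) ≠ ∞ := by
  set a : ℤ → ℝ≥0∞ := fun k =>
    ENNReal.ofReal (Real.exp (-|(k : ℝ)|) * Real.Gamma (2 * α - 1)) ^ (1 / 2 : ℝ) with ha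
  have h1 : ∀ m : Fin d → ℤ, (∫⁻ y in cube m, ‖(gammaKernel α y : ℂ)‖ₑ ^ 2) ^ (1 / 2 : ℝ)
      ≤ ∏ i, a (m i) := fun m => by
    rw [ENNReal.prod_rpow_of_nonneg (by norm_num)]
    exact ENNReal.rpow_le_rpow (lintegral_cube_gammaKernel_sq_le hα m) (by norm_num)
  refine ne_top_of_le_ne_top (ENNReal.pow_ne_top ?_)
    ((ENNReal.tsum_le_tsum h1).trans (tsum_pi_prod_le a))
  have hΓ : 0 < Real.Gamma (2 * α - 1) := Real.Gamma_pos_of_pos (by linarith)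
  have h2 : ∀ k : ℤ, a k = ENNReal.ofReal (Real.exp (-|(k : ℝ)| / 2) *
      Real.Gamma (2 * α - 1) ^ (1 / 2 : ℝ)) := fun k => by
    rw [ha]
    simp only
    rw [ENNReal.ofReal_rpow_of_nonneg (by positivity) (by norm_num),
      Real.mul_rpow (Real.exp_nonneg _) hΓ.le, ← Real.exp_mul]
    congr 3
    ring
  simp_rw [h2]
  have h3 : Summable fun k : ℤ => Real.exp (-|(k : ℝ)| / 2) := by
    have h4 : Summable fun n : ℕ => Real.exp (-(n : ℝ) / 2) := by
      have h5 : ∀ n : ℕ, Real.exp (-(n : ℝ) / 2) = Real.exp (n * (-1 / 2)) := fun n => by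
        congr 1; ring
      simp_rw [h5]
      exact Real.summable_exp_nat_mul_iff.2 (by norm_num)
    refine summable_int_iff_summable_nat_and_neg.2 ⟨?_, ?_⟩
    · simpa using h4
    · simpa using h4
  exact (h3.mul_right _).tsum_ofReal_ne_top

/-! ### Convolution with the gamma kernel -/

theorem wienerSq_congr {d : ℕ} {F : Type*} [ENorm F] {f g : E d → F} (h : f =ᵐ[volume] g) :
    wienerSq f = wienerSq g := by
  simp only [wienerSq, cubeSupSq]
  congr 1
  ext n
  rw [eLpNormEssSup_congr_ae (ae_restrict_of_ae h)]

/-- The offsets `{-1, 0}^d`: if `x` and `y` lie in the cubes of `n` and `m`, then `x - y` lies in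
one of the cubes of `n - m + e`. -/
def offsets (d : ℕ) : Finset (Fin d → ℤ) := Fintype.piFinset fun _ => {-1, 0}

theorem exists_offset {d : ℕ} (x y : E d) :
    ∃ e ∈ offsets d, floorPt (x - y) = floorPt x - floorPt y + e := by
  refine ⟨floorPt (x - y) - (floorPt x - floorPt y), ?_, by abel⟩
  refine Fintype.mem_piFinset.2 fun i => ?_
  have h1 := Int.le_floor_add_floor (x i - y i) (y i)
  have h2 := Int.le_floor_add (x i - y i) (y i)
  rw [sub_add_cancel] at h1 h2
  simp only [floorPt, Pi.sub_apply, PiLp.sub_apply, Finset.mem_insert, Finset.mem_singleton]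
  omega

/-- Convolution with a kernel whose local `L²` norms are summable maps `L²` boundedly to the
amalgam space `X^{∞,2}`: apply the Cauchy–Schwarz inequality on each cube, then Young's inequality
for sequences. -/
theorem wienerSq_convolution_le {d : ℕ} {K v : E d → ℂ} (hK : AEStronglyMeasurable K)
    (hv : AEStronglyMeasurable v) :
    wienerSq (fun x => ∫ y, K y * v (x - y)) ≤
      (∑' m : Fin d → ℤ, (∫⁻ y in cube m, ‖K y‖ₑ ^ 2) ^ (1 / 2 : ℝ)) ^ 2 *
        ((offsets d).card * ∫⁻ z, ‖v z‖ₑ ^ 2) := by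
  set κ : (Fin d → ℤ) → ℝ≥0∞ := fun m => (∫⁻ y in cube m, ‖K y‖ₑ ^ 2) ^ (1 / 2 : ℝ) with hκ
  set N : (Fin d → ℤ) → ℝ≥0∞ := fun j => ∫⁻ z in cube j, ‖v z‖ₑ ^ 2 with hN
  set b : (Fin d → ℤ) → ℝ≥0∞ := fun j => (∑ e ∈ offsets d, N (j + e)) ^ (1 / 2 : ℝ) with hb
  have hb2 : ∑' j, b j ^ 2 = (offsets d).card * ∫⁻ z, ‖v z‖ₑ ^ 2 := by
    have h1 : ∀ j, b j ^ 2 = ∑ e ∈ offsets d, N (j + e) := fun j => by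
      rw [hb, ← ENNReal.rpow_natCast, ← ENNReal.rpow_mul]; simp
    simp_rw [h1]
    rw [Summable.tsum_finsetSum fun _ _ => ENNReal.summable, lintegral_eq_tsum_cube]
    have h2 : ∀ e : Fin d → ℤ, ∑' j, N (j + e) = ∑' j, N j := fun e =>
      (Equiv.addRight e).tsum_eq N
    simp_rw [h2]
    rw [Finset.sum_const, nsmul_eq_mul]
  rw [← hb2]
  refine le_trans (ENNReal.tsum_le_tsum fun n => ?_) (tsum_conv_sq_le κ b)
  refine pow_le_pow_left' (essSup_cube_le (Filter.Eventually.of_forall fun x hx => ?_)) 2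
  have hvx : AEStronglyMeasurable (fun y => v (x - y)) volume :=
    hv.comp_quasiMeasurePreserving (quasiMeasurePreserving_sub_left volume x)
  refine (enorm_integral_le_lintegral_enorm _).trans ?_
  rw [lintegral_eq_tsum_cube]
  refine ENNReal.tsum_le_tsum fun m => ?_
  have hCS := ENNReal.lintegral_mul_le_Lp_mul_Lq (volume.restrict (cube m))
    Real.HolderConjugate.two_two hK.enorm.restrict hvx.enorm.restrict
  simp only [ENNReal.rpow_two, Pi.mul_apply] at hCS
  simp_rw [enorm_mul]
  refine hCS.trans ?_
  simp only [hκ, hb]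
  gcongr
  rw [← lintegral_indicator (measurableSet_cube m)]
  have h3 : ∀ y, (cube m).indicator (fun y => ‖v (x - y)‖ₑ ^ 2) y
      ≤ ∑ e ∈ offsets d, (cube (n - m + e)).indicator (fun z => ‖v z‖ₑ ^ 2) (x - y) := by
    intro y
    by_cases hy : y ∈ cube m
    · obtain ⟨e, he, hxy⟩ := exists_offset x y
      rw [mem_cube.1 hx, mem_cube.1 hy] at hxy
      rw [Set.indicator_of_mem hy]
      refine le_trans (le_of_eq ?_) (Finset.single_le_sum (f := fun e =>
        (cube (n - m + e)).indicator (fun z => ‖v z‖ₑ ^ 2) (x - y)) (fun _ _ => zero_le) he)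
      rw [Set.indicator_of_mem (mem_cube.2 hxy)]
    · rw [Set.indicator_of_notMem hy]
      exact zero_le
  refine (lintegral_mono h3).trans (le_of_eq ?_)
  rw [lintegral_sub_left_eq_self
    (fun w => ∑ e ∈ offsets d, (cube (n - m + e)).indicator (fun z => ‖v z‖ₑ ^ 2) w) x,
    lintegral_finsetSum' _ fun e _ => (hv.enorm.pow_const 2).indicator (measurableSet_cube _)]
  simp_rw [lintegral_indicator (measurableSet_cube _)]
  rfl

theorem memLp_fourier_of_integrable {d : ℕ} {K : E d → ℂ} (hK : Integrable K) :
    MemLp (𝓕 K) ∞ (volume : Measure (E d)) :=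
  memLp_top_of_bound (continuous_fourier_of_integrable hK).aestronglyMeasurable _
    (Filter.Eventually.of_forall (norm_fourier_le_integral K))

/-- For Schwartz functions `u`, the Fourier multiplier with symbol `K̂` is the convolution with `K`. -/
theorem fourierInv_mulL2_toLp {d : ℕ} {K : E d → ℂ} (hK : Integrable K)
    (hsum : ∑' m : Fin d → ℤ, (∫⁻ y in cube m, ‖K y‖ₑ ^ 2) ^ (1 / 2 : ℝ) ≠ ∞) (u : 𝓢(E d, ℂ)) :
    (𝓕⁻ (mulL2 (memLp_fourier_of_integrable hK) (𝓕 (u.toLp 2 : L2 d))) : L2 d)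
      =ᵐ[volume] fun x => ∫ y, K y * u (x - y) := by
  set g : E d → ℂ := fun x => ∫ y, K y * u (x - y) with hg
  have hgc : g = MeasureTheory.convolution K u (ContinuousLinearMap.mul ℂ ℂ) volume := by
    funext x
    simp only [hg, convolution_def, ContinuousLinearMap.mul_apply']
  have hgi : Integrable g := by
    rw [hgc]
    exact hK.integrable_convolution _ u.integrable
  have hg2 : MemLp g 2 (volume : Measure (E d)) := by
    refine ⟨hgi.aestronglyMeasurable, ?_⟩
    have h1 : eLpNorm g 2 volume ^ 2 < ∞ := by
      rw [eLpNorm_two_sq]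
      refine ((lintegral_enorm_sq_le_wienerSq g).trans (wienerSq_convolution_le
        hK.aestronglyMeasurable u.continuous.aestronglyMeasurable)).trans_lt ?_
      have hu : ∫⁻ z, ‖u z‖ₑ ^ 2 < ∞ := by
        rw [← eLpNorm_two_sq]
        exact ENNReal.pow_lt_top (u.memLp 2 volume).eLpNorm_lt_top
      exact ENNReal.mul_lt_top (ENNReal.pow_lt_top hsum.lt_top)
        (ENNReal.mul_lt_top (ENNReal.natCast_lt_top _) hu)
    by_contra h2
    rw [not_lt, top_le_iff] at h2
    simp [h2] at h1
  have h3 : mulL2 (memLp_fourier_of_integrable hK) (𝓕 (u.toLp 2 : L2 d)) = 𝓕 (hg2.toLp g) := by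
    refine Lp.ext ?_
    have h4 := coeFn_mulL2 (memLp_fourier_of_integrable hK) (𝓕 (u.toLp 2 : L2 d))
    have h5 := fourier_toLp_eq hgi hg2
    have h6 : ((𝓕 u : 𝓢(E d, ℂ)).toLp 2 volume : L2 d) =ᵐ[volume] 𝓕 (u : E d → ℂ) :=
      (𝓕 u : 𝓢(E d, ℂ)).coeFn_toLp 2 volume
    have h7 : 𝓕 g = fun ξ => 𝓕 K ξ * 𝓕 (u : E d → ℂ) ξ := by
      rw [hgc]
      exact funext (Real.fourier_mul_convolution_eq hK u.integrable)
    rw [SchwartzMap.toLp_fourier_eq] at h4 ⊢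
    refine h4.trans (Filter.EventuallyEq.trans ?_ h5.symm)
    rw [h7]
    filter_upwards [h6] with ξ hξ
    rw [hξ]
  rw [h3, FourierTransform.fourierInv_fourier_eq]
  exact hg2.coeFn_toLp

/-- A form of the Sobolev embedding: if `ĝ = K̂ û` with `u ∈ L²` and the local `L²` norms of `K` are
summable, then `g` lies in `X^{∞,2}`. -/
theorem exists_wienerSq_le_of_fourier_eq_mul {d : ℕ} {K : E d → ℂ} (hK : Integrable K)
    (hsum : ∑' m : Fin d → ℤ, (∫⁻ y in cube m, ‖K y‖ₑ ^ 2) ^ (1 / 2 : ℝ) ≠ ∞) :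
    ∃ C : ℝ≥0∞, C ≠ ∞ ∧ ∀ g u : L2 d,
      (𝓕 g : L2 d) =ᵐ[volume] (fun ξ => 𝓕 K ξ * (𝓕 u : L2 d) ξ) → wienerSq g ≤ C * ‖u‖ₑ ^ 2 := by
  set C : ℝ≥0∞ := (∑' m : Fin d → ℤ, (∫⁻ y in cube m, ‖K y‖ₑ ^ 2) ^ (1 / 2 : ℝ)) ^ 2 *
    (offsets d).card with hC
  have hCt : C ≠ ∞ := ENNReal.mul_ne_top (ENNReal.pow_ne_top hsum) (ENNReal.natCast_ne_top _)
  refine ⟨C, hCt, ?_⟩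
  set T : L2 d → L2 d := fun u => 𝓕⁻ (mulL2 (memLp_fourier_of_integrable hK) (𝓕 u : L2 d)) with hT
  have hTc : Continuous T :=
    (Lp.fourierTransformₗᵢ (E d) ℂ).symm.continuous.comp
      ((mulL2 (memLp_fourier_of_integrable hK)).continuous.comp
        (Lp.fourierTransformₗᵢ (E d) ℂ).continuous)
  have key : ∀ u : L2 d, wienerSq (T u) ≤ C * ‖u‖ₑ ^ 2 := by
    intro u
    refine DenseRange.induction_on (p := fun u : L2 d => wienerSq (T u) ≤ C * ‖u‖ₑ ^ 2)
      (SchwartzMap.denseRange_toLpCLM (E := E d) (F := ℂ) (p := 2) (μ := volume)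
        ENNReal.ofNat_ne_top) u ?_ ?_
    · refine IsSeqClosed.isClosed fun w w₀ hw hw₀ => ?_
      refine wienerSq_le_of_tendsto (hTc.tendsto _ |>.comp hw₀) ?_ hw
      exact ENNReal.Tendsto.const_mul (ENNReal.Tendsto.pow ((continuous_enorm.tendsto _).comp hw₀))
        (Or.inr hCt)
    · intro v
      rw [SchwartzMap.toLpCLM_apply, wienerSq_congr (fourierInv_mulL2_toLp hK hsum v)]
      refine (wienerSq_convolution_le hK.aestronglyMeasurable
        v.continuous.aestronglyMeasurable).trans (le_of_eq ?_)
      rw [enorm_sq_eq_lintegral, hC, mul_assoc]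
      congr 2
      refine lintegral_congr_ae ?_
      filter_upwards [v.coeFn_toLp 2] with x hx
      rw [hx]
  intro g u hgu
  have h1 : g = T u := by
    have h2 : (𝓕 g : L2 d) = mulL2 (memLp_fourier_of_integrable hK) (𝓕 u : L2 d) :=
      Lp.ext (hgu.trans (coeFn_mulL2 _ _).symm)
    simp only [hT]
    rw [← h2]
    exact (FourierTransform.fourierInv_fourier_eq (F := L2 d) g).symm
  rw [h1]
  exact key u

/-! ### Generators satisfying the weighted periodization condition -/

theorem weight_pos {d : ℕ} (ω : E d) : 0 < weight ω :=
  Finset.prod_pos fun i _ => Real.sqrt_pos.2 (by positivity)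

/-- Dividing `ψ̂` by the Fourier transform of the gamma kernel amounts to multiplying it by the
weight `v^α`, up to a constant. The quotient is the Fourier transform of a function with bounded
periodization, and `ψ` is the convolution of this function with the kernel. -/
theorem synthBounded_of_weightedPeriodization {d : ℕ} {ψ : L2 d} (h : WeightedPeriodization ψ) :
    SynthBounded ψ := by
  obtain ⟨α, B, hα, -, hB⟩ := h
  have hα0 : 0 < α := by linarith
  set K : E d → ℂ := gammaKernel α with hKdef
  have hK : Integrable K := integrable_gammaKernel hα0
  have hΓ : 0 < Real.Gamma α ^ d := pow_pos (Real.Gamma_pos_of_pos hα0) d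
  have hnorm : ∀ ξ : E d, ‖𝓕 K ξ‖ = Real.Gamma α ^ d * weight ((2 * Real.pi) • ξ) ^ (-α) :=
    norm_fourier_gammaKernel hα0
  have hne : ∀ ξ : E d, 𝓕 K ξ ≠ 0 := fun ξ => by
    rw [← norm_pos_iff, hnorm]
    exact mul_pos hΓ (Real.rpow_pos_of_pos (weight_pos _) _)
  set D : ℝ≥0∞ := ENNReal.ofReal ((Real.Gamma α ^ d)⁻¹) ^ 2 * ENNReal.ofReal B with hD
  have hDt : D ≠ ∞ := ENNReal.mul_ne_top (ENNReal.pow_ne_top ENNReal.ofReal_ne_top)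
    ENNReal.ofReal_ne_top
  set q : E d → ℂ := fun ξ => (𝓕 K ξ)⁻¹ * (𝓕 ψ : L2 d) ξ with hq
  have hqm : AEStronglyMeasurable q volume :=
    ((continuous_fourier_of_integrable hK).inv₀ hne).aestronglyMeasurable.mul
      (Lp.aestronglyMeasurable _)
  have hqn : ∀ ξ : E d, ‖q ξ‖ₑ ^ 2 = ENNReal.ofReal ((Real.Gamma α ^ d)⁻¹) ^ 2 *
      ‖((weight ((2 * Real.pi) • ξ) ^ α : ℝ) : ℂ) * (𝓕 ψ : L2 d) ξ‖ₑ ^ 2 := fun ξ => by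
    have h1 : ‖(𝓕 K ξ)⁻¹‖ₑ = ENNReal.ofReal ((Real.Gamma α ^ d)⁻¹) *
        ‖((weight ((2 * Real.pi) • ξ) ^ α : ℝ) : ℂ)‖ₑ := by
      rw [← ofReal_norm, ← ofReal_norm, norm_inv, hnorm, Complex.norm_real,
        Real.norm_of_nonneg (Real.rpow_nonneg (weight_pos _).le _),
        ← ENNReal.ofReal_mul (by positivity), mul_inv, Real.rpow_neg (weight_pos _).le, inv_inv]
    simp only [hq, enorm_mul, h1, mul_pow, mul_assoc]
  have hper : ∀ᵐ ξ : E d, ξ ∈ cube 0 → ∑' k : Fin d → ℤ, ‖q (ξ - latticePt k)‖ₑ ^ 2 ≤ D := by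
    filter_upwards [ae_two_pi_smul hB] with ξ hξ h0
    have h1 : ∀ i, ((2 * Real.pi) • ξ : E d) i ∈ Set.Icc 0 (2 * Real.pi) := fun i => by
      have h2 : ⌊ξ i⌋ = 0 := congrFun (mem_cube.1 h0) i
      rw [Int.floor_eq_zero_iff] at h2
      simp only [PiLp.smul_apply, smul_eq_mul, Set.mem_Icc]
      have := Real.pi_pos
      constructor
      · exact mul_nonneg (by positivity) h2.1
      · exact mul_le_of_le_one_right (by positivity) h2.2.le
    have h3 := hξ h1
    simp_rw [fourierAng_two_pi_smul] at h3
    simp_rw [hqn, smul_sub]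
    rw [ENNReal.tsum_mul_left]
    exact mul_le_mul_right h3 _
  have hq2 : MemLp q 2 (volume : Measure (E d)) := by
    refine ⟨hqm, ?_⟩
    have h1 : eLpNorm q 2 volume ^ 2 < ∞ := by
      rw [eLpNorm_two_sq, lintegral_eq_periodization (hqm.enorm.pow_const 2)]
      calc ∫⁻ ξ in cube 0, ∑' k : Fin d → ℤ, ‖q (ξ - latticePt k)‖ₑ ^ 2
          ≤ ∫⁻ _ξ in (cube 0 : Set (E d)), D :=
            lintegral_mono_ae ((ae_restrict_iff' (measurableSet_cube 0)).2 hper)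
        _ = D * volume (cube 0 : Set (E d)) := setLIntegral_const _ _
        _ < ∞ := ENNReal.mul_lt_top hDt.lt_top ((volume_cube 0).trans_lt ENNReal.one_lt_top)
    by_contra h2
    rw [not_lt, top_le_iff] at h2
    simp [h2] at h1
  set η : L2 d := 𝓕⁻ (hq2.toLp q) with hη
  have hηF : (𝓕 η : L2 d) =ᵐ[volume] q := by
    rw [hη, FourierTransform.fourier_fourierInv_eq]
    exact hq2.coeFn_toLp
  have hηper : ∀ᵐ ξ : E d, ξ ∈ cube 0 → periodization η ξ ≤ D := by
    have h1 : ∀ᵐ ξ : E d, ∀ k : Fin d → ℤ,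
        (𝓕 η : L2 d) (ξ - latticePt k) = q (ξ - latticePt k) :=
      ae_all_iff.2 fun k => ae_sub (latticePt k) hηF
    filter_upwards [hper, h1] with ξ h2 h3 h4
    simp_rw [periodization, h3]
    exact h2 h4
  obtain ⟨C, hC, hsob⟩ := exists_wienerSq_le_of_fourier_eq_mul hK
    (tsum_sqrt_lintegral_gammaKernel_ne_top hα)
  refine ⟨C * D, ENNReal.mul_ne_top hC hDt, fun c => ?_⟩
  rw [mul_assoc]
  refine (hsob (synth ψ c) (synth η c) ?_).trans
    (mul_le_mul_right (enorm_synth_sq_le hDt hηper c) C)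
  filter_upwards [fourier_synth ψ c, fourier_synth η c, hηF] with ξ h1 h2 h3
  rw [h1, h2, h3, hq]
  simp only
  rw [mul_left_comm (𝓕 K ξ), mul_inv_cancel_left₀ (hne ξ)]

theorem RegularityCondition.synthBounded {d : ℕ} {ψ : L2 d} (h : RegularityCondition ψ) :
    SynthBounded ψ :=
  h.elim synthBounded_of_memAmalgam synthBounded_of_weightedPeriodization

/-! ### Distributional derivatives of translates and dilates -/

theorem integral_affine {d : ℕ} {s : ℝ} (hs : 0 < s) (v : E d) (F : E d → ℂ) :
    ∫ x, F (s⁻¹ • (x - v)) = (s ^ d : ℝ) • ∫ x, F x := by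
  rw [← (measurableEmbedding_affine hs v).integral_map, map_affine hs, integral_smul_measure,
    ENNReal.toReal_ofReal (by positivity)]

theorem isPartialDeriv_iff {d : ℕ} {j : Fin d} {f g : L2 d} :
    IsPartialDeriv j f g ↔ ∀ χ : 𝓢(E d, ℂ),
      ∫ x, χ x * g x = -∫ x, (∂_{(EuclideanSpace.single j (1 : ℝ) : E d)} χ) x * f x := by
  rw [IsPartialDeriv, DFunLike.ext_iff]
  refine forall_congr' fun χ => ?_
  rw [TemperedDistribution.lineDerivOp_apply_apply, map_neg, Lp.toTemperedDistribution_apply,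
    Lp.toTemperedDistribution_apply]
  simp only [smul_eq_mul]
  exact eq_comm

theorem isClosed_isPartialDeriv {d : ℕ} (j : Fin d) :
    IsClosed {p : L2 d × L2 d | IsPartialDeriv j p.1 p.2} := by
  refine isClosed_eq ?_ ?_
  · exact ((lineDerivOpCLM ℂ 𝓢'(E d, ℂ) (EuclideanSpace.single j (1 : ℝ) : E d)).continuous.comp
      (Lp.toTemperedDistributionCLM ℂ volume 2).continuous).comp continuous_fst
  · exact (Lp.toTemperedDistributionCLM ℂ volume 2).continuous.comp continuous_snd

theorem IsPartialDeriv.sum {d : ℕ} {j : Fin d} {ι : Type*} (t : Finset ι) (c : ι → ℂ)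
    {f g : ι → L2 d} (h : ∀ i ∈ t, IsPartialDeriv j (f i) (g i)) :
    IsPartialDeriv j (∑ i ∈ t, c i • f i) (∑ i ∈ t, c i • g i) := by
  have h1 : ∀ i ∈ t, (lineDerivOpCLM ℂ 𝓢'(E d, ℂ) (EuclideanSpace.single j (1 : ℝ) : E d))
      (Lp.toTemperedDistributionCLM ℂ volume 2 (f i))
      = Lp.toTemperedDistributionCLM ℂ volume 2 (g i) := h
  change (lineDerivOpCLM ℂ 𝓢'(E d, ℂ) (EuclideanSpace.single j (1 : ℝ) : E d))
    (Lp.toTemperedDistributionCLM ℂ volume 2 (∑ i ∈ t, c i • f i))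
      = Lp.toTemperedDistributionCLM ℂ volume 2 (∑ i ∈ t, c i • g i)
  simp only [map_sum, map_smul]
  exact Finset.sum_congr rfl fun i hi => by rw [h1 i hi]

/-- The chain rule for the affine change of variables defining the atoms, dualized to test
functions. -/
theorem IsPartialDeriv.shift {d : ℕ} {j : Fin d} {f g : L2 d} (h : IsPartialDeriv j f g) {s : ℝ}
    (hs : 0 < s) (n : Fin d → ℤ) :
    IsPartialDeriv j (shift hs n f) (((s⁻¹ : ℝ) : ℂ) • shift hs n g) := by
  rw [isPartialDeriv_iff] at h ⊢
  intro χ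
  set e : E d := EuclideanSpace.single j (1 : ℝ) with he
  set v : E d := s • latticePt n with hv
  set c : ℂ := ((s ^ (-((d : ℝ) / 2)) : ℝ) : ℂ) with hc
  -- the test function in the new variables
  set A : E d → E d := fun y => s • y + v with hA
  have hAt : A.HasTemperateGrowth := by
    have h1 : (fun y : E d => s • y).HasTemperateGrowth :=
      (s • ContinuousLinearMap.id ℝ (E d)).hasTemperateGrowth
    exact h1.add (Function.HasTemperateGrowth.const v)
  have hAl : AntilipschitzWith (s⁻¹).toNNReal A := by
    refine AntilipschitzWith.of_le_mul_dist fun x y => ?_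
    simp only [hA, dist_add_right, dist_smul₀, Real.norm_of_nonneg hs.le,
      Real.coe_toNNReal _ (inv_nonneg.2 hs.le)]
    rw [← mul_assoc, inv_mul_cancel₀ hs.ne', one_mul]
  set χ' : 𝓢(E d, ℂ) := compCLMOfAntilipschitz ℂ hAt hAl χ with hχ'
  have hχ'A : ∀ y, χ' y = χ (A y) := fun y => rfl
  have hAinv : ∀ x, A (s⁻¹ • (x - v)) = x := fun x => by
    simp only [hA, smul_smul, mul_inv_cancel₀ hs.ne', one_smul, sub_add_cancel]
  have hd : ∀ y, (∂_{e} χ') y = (s : ℂ) * (∂_{e} χ) (A y) := by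
    intro y
    rw [lineDerivOp_apply_eq_fderiv, lineDerivOp_apply_eq_fderiv]
    have h1 : HasFDerivAt A (s • ContinuousLinearMap.id ℝ (E d)) y :=
      ((hasFDerivAt_id y).const_smul s).add_const v
    have h2 : HasFDerivAt χ' ((fderiv ℝ χ (A y)).comp (s • ContinuousLinearMap.id ℝ (E d))) y :=
      (χ.differentiableAt.hasFDerivAt).comp y h1
    rw [h2.fderiv]
    simp
  have hsc : (s : ℂ) ≠ 0 := by exact_mod_cast hs.ne'
  have hL : ∫ x, χ x * (((s⁻¹ : ℝ) : ℂ) • RevHolder.shift hs n g : L2 d) x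
      = ∫ x, (fun y => ((s⁻¹ : ℝ) : ℂ) * c * (χ' y * g y)) (s⁻¹ • (x - v)) := by
    refine integral_congr_ae ?_
    filter_upwards [Lp.coeFn_smul ((s⁻¹ : ℝ) : ℂ) (RevHolder.shift hs n g), coeFn_shift hs n g]
      with x h1 h2
    rw [h1, Pi.smul_apply, h2, atom, smul_eq_mul, hχ'A, hAinv]
    ring
  have hR : ∫ x, (∂_{e} χ) x * (RevHolder.shift hs n f : L2 d) x
      = ∫ x, (fun y => ((s⁻¹ : ℝ) : ℂ) * c * ((∂_{e} χ') y * f y)) (s⁻¹ • (x - v)) := by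
    refine integral_congr_ae ?_
    filter_upwards [coeFn_shift hs n f] with x h2
    simp only [h2, atom, hd, hAinv]
    push_cast
    field_simp
    rfl
  rw [hL.trans (integral_affine hs v fun y => ((s⁻¹ : ℝ) : ℂ) * c * (χ' y * g y)),
    hR.trans (integral_affine hs v fun y => ((s⁻¹ : ℝ) : ℂ) * c * ((∂_{e} χ') y * f y)),
    integral_const_mul, integral_const_mul, h χ']
  simp only [mul_neg, smul_neg]

theorem IsPartialDeriv.synth {d : ℕ} {j : Fin d} {φ ψ : L2 d} (h : IsPartialDeriv j φ ψ)
    (c : (Fin d → ℤ) →₀ ℂ) : IsPartialDeriv j (synth φ c) (synth ψ c) := by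
  rw [synth_eq, synth_eq]
  refine IsPartialDeriv.sum _ _ fun k _ => ?_
  simpa using h.shift one_pos k

/-! ### Passage to the closure -/

theorem approxSpace_one_eq {d : ℕ} (φ : L2 d) :
    (approxSpace φ 1 one_pos : Set (L2 d)) = closure (Set.range (synth φ)) := by
  rw [approxSpace, Submodule.topologicalClosure_coe]
  congr 1
  ext f
  exact Finsupp.mem_span_range_iff_exists_finsupp

theorem exists_shift_eq_of_mem_approxSpace {d : ℕ} {φ : L2 d} {s : ℝ} (hs : 0 < s) {f : L2 d}
    (hf : f ∈ approxSpace φ s hs) : ∃ g ∈ approxSpace φ 1 one_pos, shift hs 0 g = f := by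
  have h1 : (approxSpace φ s hs : Set (L2 d)) = shift hs 0 '' approxSpace φ 1 one_pos := by
    rw [approxSpace, approxSpace, Submodule.topologicalClosure_coe,
      Submodule.topologicalClosure_coe,
      ← (shift hs (0 : Fin d → ℤ)).isometry.isClosedEmbedding.closure_image_eq]
    congr 1
    have h2 : (Set.range fun n : Fin d → ℤ => (memLp_atom φ hs n).toLp (atom φ s n))
        = (shift hs 0).toLinearMap ''
          (Set.range fun n : Fin d → ℤ => (memLp_atom φ one_pos n).toLp (atom φ 1 n)) := by
      rw [← Set.range_comp]
      congr 1
      funext n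
      exact shift_eq_comp hs n φ
    rw [h2, Submodule.span_image, Submodule.map_coe]
    rfl
  have h2 : f ∈ shift hs 0 '' (approxSpace φ 1 one_pos : Set (L2 d)) := h1 ▸ hf
  exact h2

/-- The lower Riesz bound for `φ` makes the map `∑ₖ cₖ φ(· - k) ↦ ∑ₖ cₖ ψ(· - k)` bounded from `L²`
to `X^{∞,2}`; the elements of the closure of its graph inherit the bound. -/
theorem exists_wienerSq_le_of_mem_approxSpace {d : ℕ} {φ ψ : L2 d} (hφ : RieszCondition φ)
    (hψ : SynthBounded ψ) :
    ∃ C : ℝ≥0∞, C ≠ ∞ ∧ ∀ g ∈ approxSpace φ 1 one_pos, ∃ h : L2 d, wienerSq h ≤ C * ‖g‖ₑ ^ 2 ∧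
      (g, h) ∈ closure (Set.range fun c => (synth φ c, synth ψ c)) := by
  obtain ⟨A, hA0, hAt, hA⟩ := hφ.exists_le_periodization
  obtain ⟨B, hBt, hB⟩ := hψ
  have hCt : B * A⁻¹ ≠ ∞ := ENNReal.mul_ne_top hBt (ENNReal.inv_ne_top.2 hA0)
  have hbound : ∀ c, wienerSq (synth ψ c) ≤ B * A⁻¹ * ‖synth φ c‖ₑ ^ 2 := fun c => by
    refine (hB c).trans ?_
    rw [mul_assoc]
    refine mul_le_mul_right ?_ B
    rw [mul_comm, ← div_eq_mul_inv, ENNReal.le_div_iff_mul_le (Or.inl hA0) (Or.inl hAt), mul_comm]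
    exact mul_tsum_le_enorm_synth_sq hAt hA c
  refine ⟨B * A⁻¹, hCt, fun g hg => ?_⟩
  have hg' : g ∈ closure (Set.range (synth φ)) := by
    rw [← approxSpace_one_eq]; exact hg
  obtain ⟨u, hu, hug⟩ := mem_closure_iff_seq_limit.1 hg'
  choose c hc using hu
  -- `wienerSq` dominates the squared `L²` norm, so the second components form a Cauchy sequence
  set R : ℝ := Real.sqrt (B * A⁻¹).toReal with hR
  have hnorm : ∀ c, ‖synth ψ c‖ ≤ R * ‖synth φ c‖ := fun c => by
    have h1 := (enorm_sq_le_wienerSq (synth ψ c)).trans (hbound c)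
    rw [← ofReal_norm, ← ofReal_norm, ← ENNReal.ofReal_pow (norm_nonneg _),
      ← ENNReal.ofReal_pow (norm_nonneg _), ← ENNReal.ofReal_toReal hCt,
      ← ENNReal.ofReal_mul ENNReal.toReal_nonneg,
      ENNReal.ofReal_le_ofReal_iff (by positivity)] at h1
    refine abs_le_of_sq_le_sq' ?_ (by positivity) |>.2
    rwa [mul_pow, hR, Real.sq_sqrt ENNReal.toReal_nonneg]
  have hcau : CauchySeq fun i => synth ψ (c i) := by
    have h1 := Metric.cauchySeq_iff.1 hug.cauchySeq
    refine Metric.cauchySeq_iff.2 fun ε hε => ?_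
    have hR1 : 0 < R + 1 := by positivity
    obtain ⟨N, hN⟩ := h1 (ε / (R + 1)) (by positivity)
    refine ⟨N, fun m hm n hn => ?_⟩
    have h2 := hN m hm n hn
    rw [← hc m, ← hc n, dist_eq_norm, ← synth_sub, lt_div_iff₀ hR1] at h2
    rw [dist_eq_norm, ← synth_sub]
    have h3 := hnorm (c m - c n)
    nlinarith [norm_nonneg (synth φ (c m - c n))]
  obtain ⟨h, hh⟩ := cauchySeq_tendsto_of_complete hcau
  refine ⟨h, wienerSq_le_of_tendsto hh ?_ fun i => hbound (c i), ?_⟩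
  · refine ENNReal.Tendsto.const_mul (ENNReal.Tendsto.pow ?_) (Or.inr hCt)
    simp only [hc]
    exact (continuous_enorm.tendsto _).comp hug
  · refine mem_closure_of_tendsto (f := fun i => (synth φ (c i), synth ψ (c i)))
      (Filter.Tendsto.prodMk_nhds ?_ hh) (Filter.Eventually.of_forall fun i => ⟨c i, rfl⟩)
    simpa only [hc] using hug

/-! ### Rescaling -/

theorem ae_enorm_sq_shift_le {d : ℕ} {s : ℝ} (hs : 0 < s) (h : L2 d) :
    ∀ᵐ x, ‖(shift hs 0 h : L2 d) x‖ₑ ^ 2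
      ≤ ENNReal.ofReal (s ^ d)⁻¹ * cubeSupSq h (floorPt (s⁻¹ • x)) := by
  have h0 : (latticePt (0 : Fin d → ℤ) : E d) = 0 := by ext i; simp [latticePt]
  filter_upwards [coeFn_shift hs 0 h, ae_affine hs 0 (ae_le_cubeSupSq (h : E d → ℂ))] with x h1 h2
  rw [sub_zero] at h2
  rw [h1, atom, h0, smul_zero, sub_zero, enorm_mul, mul_pow, enorm_atom_factor_sq hs]
  exact mul_le_mul_right h2 _

/-- The powers of `s` in `amalgamNorm_sq_le` and in the normalization of the atoms combine to
`((s + 2r)/s)^d ≤ 2^d (1 + r/s)^d`. The summand `1` keeps the constant positive. -/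
theorem amalgamNorm_le_of_tsum_le {d : ℕ} {F : Type*} [NormedAddCommGroup F] {f : E d → F}
    {W : (Fin d → ℤ) → ℝ≥0∞} {r s t a : ℝ} (hr : 0 < r) (hs : 0 < s) (ht : 0 ≤ t) (ha : 0 ≤ a)
    {C : ℝ≥0∞} (hC : C ≠ ∞)
    (h : ∀ᵐ x, ‖f x‖ₑ ^ 2 ≤ ENNReal.ofReal (t ^ 2 * (s ^ d)⁻¹) * W (floorPt (s⁻¹ • x)))
    (hW : ∑' n, W n ≤ C * ENNReal.ofReal (a ^ 2)) :
    amalgamNorm ∞ 2 r f ≤ ENNReal.ofReal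
      ((Real.sqrt (2 ^ d * C.toReal) + 1) * t * (1 + r / s) ^ ((d : ℝ) / 2) * a) := by
  have h1 := amalgamNorm_sq_le f (fun n => ENNReal.ofReal (t ^ 2 * (s ^ d)⁻¹) * W n) hr hs h
  rw [ENNReal.tsum_mul_left] at h1
  have hq : 0 < 1 + r / s := by positivity
  have h2 : amalgamNorm ∞ 2 r f ^ 2 ≤ ENNReal.ofReal
      ((Real.sqrt (2 ^ d * C.toReal) + 1) * t * (1 + r / s) ^ ((d : ℝ) / 2) * a) ^ 2 := by
    refine h1.trans ((mul_le_mul_right (mul_le_mul_right hW _) _).trans ?_)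
    rw [← ENNReal.ofReal_toReal hC, ← ENNReal.ofReal_mul ENNReal.toReal_nonneg,
      ← ENNReal.ofReal_mul (by positivity), ← ENNReal.ofReal_mul (by positivity),
      ← ENNReal.ofReal_pow (by positivity), ENNReal.toReal_ofReal ENNReal.toReal_nonneg]
    refine ENNReal.ofReal_le_ofReal ?_
    have h3 : ((1 + r / s) ^ ((d : ℝ) / 2)) ^ 2 = (1 + r / s) ^ d := by
      rw [← Real.rpow_natCast, ← Real.rpow_mul hq.le, ← Real.rpow_natCast]
      congr 1
      push_cast
      ring
    have h4 : (s + 2 * r) ^ d * (s ^ d)⁻¹ ≤ 2 ^ d * (1 + r / s) ^ d := by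
      rw [← inv_pow, ← mul_pow, ← mul_pow]
      refine pow_le_pow_left₀ (by positivity) ?_ d
      have : (s + 2 * r) * s⁻¹ = 1 + 2 * (r / s) := by field_simp
      rw [this]
      linarith
    have h5 : 2 ^ d * C.toReal ≤ (Real.sqrt (2 ^ d * C.toReal) + 1) ^ 2 := by
      have := Real.sq_sqrt (show 0 ≤ 2 ^ d * C.toReal by positivity)
      nlinarith [Real.sqrt_nonneg (2 ^ d * C.toReal)]
    calc (s + 2 * r) ^ d * (t ^ 2 * (s ^ d)⁻¹ * (C.toReal * a ^ 2))
        = ((s + 2 * r) ^ d * (s ^ d)⁻¹) * (C.toReal * t ^ 2 * a ^ 2) := by ring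
      _ ≤ (2 ^ d * (1 + r / s) ^ d) * (C.toReal * t ^ 2 * a ^ 2) := by gcongr
      _ = (2 ^ d * C.toReal) * ((1 + r / s) ^ d * t ^ 2 * a ^ 2) := by ring
      _ ≤ (Real.sqrt (2 ^ d * C.toReal) + 1) ^ 2 * ((1 + r / s) ^ d * t ^ 2 * a ^ 2) := by gcongr
      _ = _ := by rw [mul_pow, mul_pow, mul_pow, h3]; ring
  exact (ENNReal.pow_right_strictMono two_ne_zero).le_iff_le.1 h2

end

end RevHolder

theorem mainTheorem2 (d : ℕ) (φ : RevHolder.L2 d) (hφ : RevHolder.RieszCondition φ) :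
    (RevHolder.RegularityCondition φ →
      ∃ C : ℝ, 0 < C ∧ ∀ (r s : ℝ), 0 < r → ∀ hs : 0 < s,
        ∀ f ∈ RevHolder.approxSpace φ s hs,
          RevHolder.amalgamNorm ∞ 2 r (f : RevHolder.E d → ℂ) ≤
            ENNReal.ofReal (C * (1 + r / s) ^ ((d : ℝ) / 2) * ‖f‖)) ∧
    (RevHolder.GradientRegularityCondition φ →
      ∃ C : ℝ, 0 < C ∧ ∀ (r s : ℝ), 0 < r → ∀ hs : 0 < s,
        ∀ f ∈ RevHolder.approxSpace φ s hs,
          ∃ G : Fin d → RevHolder.L2 d, (∀ j, RevHolder.IsPartialDeriv j f (G j)) ∧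
            RevHolder.amalgamNorm ∞ 2 r
                (fun x : RevHolder.E d => Real.sqrt (∑ j, ‖G j x‖ ^ 2)) ≤
              ENNReal.ofReal (C * s⁻¹ * (1 + r / s) ^ ((d : ℝ) / 2) * ‖f‖)) := by
  have henorm : ∀ u : RevHolder.L2 d, ‖u‖ₑ ^ 2 = ENNReal.ofReal (‖u‖ ^ 2) := fun u => by
    rw [ENNReal.ofReal_pow (norm_nonneg _), ofReal_norm]
  constructor
  · intro hreg
    obtain ⟨C, hC, hbd⟩ := RevHolder.exists_wienerSq_le_of_mem_approxSpace hφ hreg.synthBounded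
    refine ⟨Real.sqrt (2 ^ d * C.toReal) + 1, by positivity, fun r s hr hs f hf => ?_⟩
    obtain ⟨g, hg, rfl⟩ := RevHolder.exists_shift_eq_of_mem_approxSpace hs hf
    obtain ⟨h, hh, hcl⟩ := hbd g hg
    -- for `ψ = φ` the closure of the graph is contained in the diagonal
    have hgh : g = h := by
      have h1 : (g, h) ∈ {p : RevHolder.L2 d × RevHolder.L2 d | p.1 = p.2} :=
        closure_minimal (by rintro _ ⟨c, rfl⟩; rfl) (isClosed_eq continuous_fst continuous_snd) hcl
      exact h1
    subst hgh
    have h2 := RevHolder.amalgamNorm_le_of_tsum_le (t := 1) (a := ‖g‖) hr hs zero_le_one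
      (norm_nonneg g) hC (by simpa using RevHolder.ae_enorm_sq_shift_le hs g)
      (by rw [← henorm]; exact hh)
    rw [LinearIsometry.norm_map]
    simpa using h2
  · intro hreg
    choose ψ hψ hψreg using hreg
    choose C hC hbd using fun j =>
      RevHolder.exists_wienerSq_le_of_mem_approxSpace hφ (hψreg j).synthBounded
    have hCt : ∑ j, C j ≠ ∞ := ENNReal.sum_ne_top.2 fun j _ => hC j
    refine ⟨Real.sqrt (2 ^ d * (∑ j, C j).toReal) + 1, by positivity, fun r s hr hs f hf => ?_⟩
    obtain ⟨g, hg, rfl⟩ := RevHolder.exists_shift_eq_of_mem_approxSpace hs hf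
    choose h hh hcl using fun j => hbd j g hg
    have hder : ∀ j, RevHolder.IsPartialDeriv j g (h j) := fun j => by
      have h1 : (g, h j) ∈ {p : RevHolder.L2 d × RevHolder.L2 d |
          RevHolder.IsPartialDeriv j p.1 p.2} :=
        closure_minimal (by rintro _ ⟨c, rfl⟩; exact (hψ j).synth c)
          (RevHolder.isClosed_isPartialDeriv j) (hcl j)
      exact h1
    refine ⟨fun j => ((s⁻¹ : ℝ) : ℂ) • RevHolder.shift hs 0 (h j),
      fun j => (hder j).shift hs 0, ?_⟩
    rw [LinearIsometry.norm_map]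
    refine RevHolder.amalgamNorm_le_of_tsum_le (W := fun n => ∑ j, RevHolder.cubeSupSq (h j) n)
      hr hs (inv_nonneg.2 hs.le) (norm_nonneg g) hCt ?_ ?_
    · have h1 : ∀ᵐ x, ∀ j, _ := MeasureTheory.ae_all_iff.2 fun j =>
        RevHolder.ae_enorm_sq_shift_le hs (h j)
      have h2 : ∀ᵐ x, ∀ j, _ := MeasureTheory.ae_all_iff.2 fun j =>
        MeasureTheory.Lp.coeFn_smul ((s⁻¹ : ℝ) : ℂ) (RevHolder.shift hs 0 (h j))
      filter_upwards [h1, h2] with x h3 h4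
      have h5 : ‖Real.sqrt (∑ j, ‖(((s⁻¹ : ℝ) : ℂ) • RevHolder.shift hs 0 (h j) :
          RevHolder.L2 d) x‖ ^ 2)‖ₑ ^ 2 = ∑ j, ENNReal.ofReal (s⁻¹ ^ 2) *
            ‖(RevHolder.shift hs 0 (h j) : RevHolder.L2 d) x‖ₑ ^ 2 := by
        rw [← ofReal_norm, Real.norm_of_nonneg (Real.sqrt_nonneg _),
          ← ENNReal.ofReal_pow (Real.sqrt_nonneg _), Real.sq_sqrt (by positivity),
          ENNReal.ofReal_sum_of_nonneg fun _ _ => by positivity]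
        refine Finset.sum_congr rfl fun j _ => ?_
        rw [h4 j, Pi.smul_apply, norm_smul, mul_pow, Complex.norm_real, Real.norm_eq_abs, sq_abs,
          ENNReal.ofReal_mul (by positivity), ENNReal.ofReal_pow (norm_nonneg _), ofReal_norm]
      rw [h5, ENNReal.ofReal_mul (by positivity), mul_assoc, Finset.mul_sum, Finset.mul_sum]
      exact Finset.sum_le_sum fun j _ => mul_le_mul_right (h3 j) _
    · rw [Summable.tsum_finsetSum fun _ _ => ENNReal.summable, ← henorm, Finset.sum_mul]
      exact Finset.sum_le_sum fun j _ => hh j
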